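/- Let $\mathbb K$ be a field of characteristic zero, $G$ an abelian group (written additively) and $\varepsilon:G\times G\to\mathbb K^\times$ an anti-symmetric bicharacter, i.e. $\varepsilon$ is multiplicative in each argument and $\varepsilon(g,h)\,\varepsilon(h,g)=1$ for all $g,h\in G$. Let $V=\bigoplus_{g\in G}V_g$ be a $G$-graded $\mathbb K$-vector space, write $|x|=g$ for $x\in V_g$, and let $S(V)$ be its $\varepsilon$-symmetric algebra, the quotient of the tensor algebra $T(V)$ by the two-sided ideal generated by the elements $x\otimes y-\varepsilon(|x|,|y|)\,y\otimes x$ ($x,y\in V$ homogeneous); it is $G\times\mathbb Z$-graded. Let $\mathfrak R_{gr}(S(V))$ be the following category. Its objects are the pairs $(A,\varphi_A)$, where $A=\bigoplus_{g}A_g$ is a unital associative $G$-graded $\mathbb K$-algebra with a filtration $0=F_{-1}A\subseteq F_0A\subseteq F_1A\subseteq\cdots$ by $G$-graded subspaces such that $\bigcup_nF_nA=A$, $1\in F_0A$ and $F_mA\cdot F_nA\subseteq F_{m+n}A$, and where $\varphi_A:S(V)\to\operatorname{gr}(A)=\bigoplus_{n\ge0}F_nA/F_{n-1}A$ is a $G\times\mathbb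 Z$-graded algebra isomorphism. A map $(A,\varphi_A)\to(B,\varphi_B)$ is an algebra homomorphism $\Psi:A\to B$ with $\Psi(A_g)\subseteq B_g$, $\Psi(F_nA)\subseteq F_nB$ and $\operatorname{gr}(\Psi)\circ\varphi_A=\varphi_B$. An $\varepsilon$-Lie algebra structure $L$ on $V$ is a bilinear bracket on $V$ such that, for homogeneous $x,y,z$, $[V_g,V_h]\subseteq V_{g+h}$, $[x,y]=-\varepsilon(|x|,|y|)[y,x]$ and $$\varepsilon(|z|,|x|)[x,[y,z]]+\varepsilon(|x|,|y|)[y,[z,x]]+\varepsilon(|y|,|z|)[z,[x,y]]=0 .$$ Let $Z^2_{gr}(L,\mathbb K)$ be the space of bilinear forms $\omega:V\times V\to\mathbb K$ of degree zero ($\omega(V_g,V_h)=0$ if $g+h\ne0$) with $\omega(x,y)=-\varepsilon(|x|,|y|)\,\omega(y,x)$ and $$\varepsilon(|z|,|x|)\,\omega(x,[y,z])+\varepsilon(|x|,|y|)\,\omega(y,[z,x])+\varepsilon(|y|,|z|)\,\omega(z,[x,y])=0$$ for homogeneous $x,y,z$, and let $H^2_{gr}(L,\mathbb K)$ be its quotient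 by the forms $(x,y)\mapsto -f([x,y])$ with $f:V\to\mathbb K$ linear and $f(V_g)=0$ for $g\neq0$. For $\omega\in Z^2_{gr}(L,\mathbb K)$ let $U_\omega(L)$ be the quotient of $T(V)$ by the two-sided ideal generated by the elements $x\otimes y-\varepsilon(|x|,|y|)\,y\otimes x-[x,y]-\omega(x,y)$ ($x,y$ homogeneous). Its component of degree $g$ is the image of the tensors of degree $g$, and its $n$-th filtration step is the image of the tensors of order $\le n$. Let $\varphi_\omega:S(V)\to\operatorname{gr}(U_\omega(L))$ be the algebra homomorphism that extends the canonical map $V\to F_1U_\omega(L)\to F_1U_\omega(L)/F_0U_\omega(L)$. **Theorem.** For every $\varepsilon$-Lie algebra structure $L$ on $V$ and every $\omega\in Z^2_{gr}(L,\mathbb K)$, the pair $(U_\omega(L),\varphi_\omega)$ is an object of $\mathfrak R_{gr}(S(V))$. There is a one-to-one correspondence between the pairs $(L,[\omega])$, with $L$ an $\varepsilon$-Lie algebra structure on $V$ and $[\omega]\in H^2_{gr}(L,\mathbb K)$, and the isomorphism classes of objects of $\mathfrak R_{gr}(S(V))$, under which $(L,[\omega])$ corresponds to the class of $(U_\omega(L),\varphi_\omega)$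 for each cocycle $\omega$ in $[\omega]$. In particular, for $\omega_1,\omega_2\in Z^2_{gr}(L,\mathbb K)$, the objects $(U_{\omega_1}(L),\varphi_{\omega_1})$ and $(U_{\omega_2}(L),\varphi_{\omega_2})$ are isomorphic if and only if $\omega_1$ and $\omega_2$ are cohomologous, i.e. $[\omega_1]=[\omega_2]$. -/

import Mathlib

set_option maxSynthPendingDepth 3

universe u v w t

noncomputable section

namespace ColorLie

/-- Anti-symmetric bicharacters (commutation factors) `ε : G × G → Kˣ` on an abelian group,
written additively. -/
structure IsBicharacter {K : Type u} [Field K] {G : Type w} [AddCommGroup G]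
    (ε : G → G → Kˣ) : Prop where
  antisymm : ∀ g h, ε g h * ε h g = 1
  add_right : ∀ g h k, ε g (h + k) = ε g h * ε g k
  add_left : ∀ g h k, ε (g + h) k = ε g k * ε h k

/-! ### Filtered algebras and their associated graded algebras -/

/-- A positive filtration `F₀ ⊆ F₁ ⊆ ⋯` of an algebra, i.e. a `ℤ`-filtration with `Fₙ = 0` for
`n < 0`. -/
structure AlgFiltration (K : Type u) [Field K] (A : Type t) [Ring A] [Algebra K A] where
  F : ℕ → Submodule K A
  mono : Monotone F
  one_mem : (1 : A) ∈ F 0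
  mul_mem : ∀ {m n : ℕ} {a b : A}, a ∈ F m → b ∈ F n → a * b ∈ F (m + n)

namespace AlgFiltration

variable {K : Type u} [Field K] {A : Type t} [Ring A] [Algebra K A] (fil : AlgFiltration K A)

/-- `Fₙ₋₁`, with `F₋₁ = 0`. -/
def below : ℕ → Submodule K A
  | 0 => ⊥
  | n + 1 => fil.F n

theorem mul_mem_below_left {m n : ℕ} {a b : A} (ha : a ∈ fil.below m) (hb : b ∈ fil.F n) :
    a * b ∈ fil.below (m + n) := by
  cases m with
  | zero =>
    have h0 : a = 0 := by simpa [below] using ha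
    rw [h0, zero_mul]
    exact Submodule.zero_mem _
  | succ m =>
    rw [Nat.add_right_comm]
    exact fil.mul_mem ha hb

theorem mul_mem_below_right {m n : ℕ} {a b : A} (ha : a ∈ fil.F m) (hb : b ∈ fil.below n) :
    a * b ∈ fil.below (m + n) := by
  cases n with
  | zero =>
    have h0 : b = 0 := by simpa [below] using hb
    rw [h0, mul_zero]
    exact Submodule.zero_mem _
  | succ n => exact fil.mul_mem ha hb

/-- The `n`-th component `Fₙ / Fₙ₋₁` of the associated graded algebra. -/
abbrev Gr (n : ℕ) : Type t := ↥(fil.F n) ⧸ (fil.below n).submoduleOf (fil.F n)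

/-- The class in `Fₙ / Fₙ₋₁` of an element of `Fₙ`. -/
def cls (n : ℕ) : ↥(fil.F n) →ₗ[K] fil.Gr n := Submodule.mkQ _

theorem cls_eq {n : ℕ} {a b : ↥(fil.F n)} (h : (a : A) - b ∈ fil.below n) :
    fil.cls n a = fil.cls n b :=
  (Submodule.Quotient.eq _).2 h

/-- The product `Fₘ × Fₙ → Fₘ₊ₙ`. -/
def mulF (m n : ℕ) : ↥(fil.F m) →ₗ[K] ↥(fil.F n) →ₗ[K] ↥(fil.F (m + n)) :=
  LinearMap.mk₂ K (fun a b => ⟨a.1 * b.1, fil.mul_mem a.2 b.2⟩)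
    (fun _ _ _ => Subtype.ext (add_mul _ _ _)) (fun _ _ _ => Subtype.ext (smul_mul_assoc _ _ _))
    (fun _ _ _ => Subtype.ext (mul_add _ _ _)) (fun _ _ _ => Subtype.ext (mul_smul_comm _ _ _))

/-- The product on the associated graded algebra: `[a] * [b] = [a * b]`. -/
def mulGr (m n : ℕ) : fil.Gr m →ₗ[K] fil.Gr n →ₗ[K] fil.Gr (m + n) :=
  Submodule.liftQ _
    (LinearMap.flip (Submodule.liftQ _ ((fil.mulF m n).compr₂ (fil.cls (m + n))).flip
      (fun b hb => by
        ext a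
        exact (Submodule.Quotient.mk_eq_zero _).2 (fil.mul_mem_below_right a.2 hb))))
    (fun a ha => by
      ext b
      exact (Submodule.Quotient.mk_eq_zero _).2 (fil.mul_mem_below_left ha b.2))

theorem mulGr_cls {m n : ℕ} (a : ↥(fil.F m)) (b : ↥(fil.F n)) :
    fil.mulGr m n (fil.cls m a) (fil.cls n b)
      = fil.cls (m + n) ⟨a.1 * b.1, fil.mul_mem a.2 b.2⟩ := rfl

theorem mk_cls_eq {m n : ℕ} (hmn : m = n) {a : ↥(fil.F m)} {b : ↥(fil.F n)}
    (h : (a : A) = b) :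
    GradedMonoid.mk (A := fil.Gr) m (fil.cls m a) = GradedMonoid.mk n (fil.cls n b) := by
  subst hmn
  rw [Subtype.ext h]

theorem algebraMap_mem (r : K) : algebraMap K A r ∈ fil.F 0 := by
  rw [Algebra.algebraMap_eq_smul_one]
  exact Submodule.smul_mem _ _ fil.one_mem

/-- The class in `F₀` of a scalar. -/
def scalar (r : K) : ↥(fil.F 0) := ⟨algebraMap K A r, fil.algebraMap_mem r⟩

instance gOne : GradedMonoid.GOne fil.Gr where
  one := fil.cls 0 ⟨1, fil.one_mem⟩

instance gMul : GradedMonoid.GMul fil.Gr where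
  mul {m n} a b := fil.mulGr m n a b

instance gMonoid : GradedMonoid.GMonoid fil.Gr where
  one_mul := by
    rintro ⟨n, a⟩
    induction a using Submodule.Quotient.induction_on with
    | _ a => exact fil.mk_cls_eq (zero_add n) (one_mul a.1)
  mul_one := by
    rintro ⟨n, a⟩
    induction a using Submodule.Quotient.induction_on with
    | _ a => exact fil.mk_cls_eq (add_zero n) (mul_one a.1)
  mul_assoc := by
    rintro ⟨m, a⟩ ⟨n, b⟩ ⟨k, c⟩
    induction a using Submodule.Quotient.induction_on with
    | _ a =>
    induction b using Submodule.Quotient.induction_on with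
    | _ b =>
    induction c using Submodule.Quotient.induction_on with
    | _ c => exact fil.mk_cls_eq (add_assoc m n k) (mul_assoc a.1 b.1 c.1)

instance gRing : DirectSum.GRing fil.Gr where
  __ := fil.gMonoid
  mul_zero _ := map_zero _
  zero_mul {m n} b := by
    change fil.mulGr m n 0 b = 0
    rw [map_zero, LinearMap.zero_apply]
  mul_add _ _ _ := map_add _ _ _
  add_mul {m n} a b c := by
    change fil.mulGr m n (a + b) c = fil.mulGr m n a c + fil.mulGr m n b c
    rw [map_add, LinearMap.add_apply]
  natCast n := fil.cls 0 (fil.scalar n)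
  natCast_zero := by
    rw [show fil.scalar ((0 : ℕ) : K) = 0 from Subtype.ext (by simp [scalar]), map_zero]
  natCast_succ n := by
    refine Eq.trans ?_ (map_add (fil.cls 0) _ _)
    exact congrArg _ (Subtype.ext (by simp [scalar]))
  intCast n := fil.cls 0 (fil.scalar n)
  intCast_ofNat n := by simp
  intCast_negSucc_ofNat n := by
    refine Eq.trans ?_ (map_neg (fil.cls 0) _)
    exact congrArg _ (Subtype.ext (by simp [scalar]))

instance gAlgebra : DirectSum.GAlgebra K fil.Gr where
  toFun :=
    { toFun := fun r => fil.cls 0 (fil.scalar r)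
      map_zero' := by
        rw [show fil.scalar (0 : K) = 0 from Subtype.ext (by simp [scalar]), map_zero]
      map_add' := fun r s => by
        refine Eq.trans ?_ (map_add (fil.cls 0) _ _)
        exact congrArg _ (Subtype.ext (by simp [scalar])) }
  map_one := congrArg _ (Subtype.ext (by simp [scalar]))
  map_mul r s := fil.mk_cls_eq (a := fil.scalar (r * s))
    (b := ⟨algebraMap K A r * algebraMap K A s, _⟩) rfl (map_mul _ r s)
  commutes := by
    rintro r ⟨n, a⟩
    induction a using Submodule.Quotient.induction_on with
    | _ a => exact fil.mk_cls_eq ((zero_add n).trans (add_zero n).symm) (Algebra.commutes r a.1)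
  smul_def := by
    rintro r ⟨n, a⟩
    induction a using Submodule.Quotient.induction_on with
    | _ a => exact fil.mk_cls_eq (a := r • a) (zero_add n).symm (Algebra.smul_def r a.1)

/-- The associated graded algebra `gr(A) = ⨁ₙ Fₙ / Fₙ₋₁`. -/
abbrev gr : Type t := DirectSum ℕ fil.Gr

/-- The class of `a ∈ Fₙ` in the `n`-th component of `gr(A)`. -/
def symbol (n : ℕ) : ↥(fil.F n) →ₗ[K] fil.gr := (DirectSum.lof K ℕ fil.Gr n).comp (fil.cls n)

theorem symbol_mul {m n : ℕ} (a : ↥(fil.F m)) (b : ↥(fil.F n)) :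
    fil.symbol m a * fil.symbol n b
      = fil.symbol (m + n) ⟨a.1 * b.1, fil.mul_mem a.2 b.2⟩ :=
  DirectSum.of_mul_of _ _

theorem symbol_eq {n : ℕ} {a b : ↥(fil.F n)} (h : (a : A) - b ∈ fil.below n) :
    fil.symbol n a = fil.symbol n b :=
  congrArg (DirectSum.lof K ℕ fil.Gr n) (fil.cls_eq h)

/-- The component of degree `(n, g)` of `gr(A)` when `A` has the grading `𝒜`: the classes in
`Fₙ / Fₙ₋₁` of the elements of `Fₙ ∩ A_g`. -/
def grPiece {G : Type w} (𝒜 : G → Submodule K A) (n : ℕ) (g : G) : Submodule K fil.gr :=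
  ((𝒜 g).submoduleOf (fil.F n)).map (fil.symbol n)

section Map

variable {B : Type*} [Ring B] [Algebra K B] {C : Type*} [Ring C] [Algebra K C]
  {fil} {filB : AlgFiltration K B} {filC : AlgFiltration K C}

theorem map_below {Ψ : A →ₐ[K] B} (h : ∀ n a, a ∈ fil.F n → Ψ a ∈ filB.F n) {n : ℕ} {a : A}
    (ha : a ∈ fil.below n) : Ψ a ∈ filB.below n := by
  cases n with
  | zero =>
    have h0 : a = 0 := by simpa [below] using ha
    rw [h0, map_zero]
    exact Submodule.zero_mem _
  | succ n => exact h n a ha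

/-- The map `Fₙ A / Fₙ₋₁ A → Fₙ B / Fₙ₋₁ B` induced by a filtered homomorphism. -/
def mapGr (Ψ : A →ₐ[K] B) (h : ∀ n a, a ∈ fil.F n → Ψ a ∈ filB.F n) (n : ℕ) :
    fil.Gr n →ₗ[K] filB.Gr n :=
  Submodule.mapQ _ _ (Ψ.toLinearMap.restrict (h n)) (fun _ ha => map_below h ha)

/-- The homomorphism `gr(Ψ) : gr(A) → gr(B)` of graded algebras induced by a filtered
homomorphism `Ψ`. -/
def map (Ψ : A →ₐ[K] B) (h : ∀ n a, a ∈ fil.F n → Ψ a ∈ filB.F n) : fil.gr →ₐ[K] filB.gr :=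
  DirectSum.toAlgebra K fil.Gr
    (fun n => (DirectSum.lof K ℕ filB.Gr n).comp (mapGr Ψ h n))
    (by
      refine congrArg (DirectSum.lof K ℕ filB.Gr 0) (congrArg (filB.cls 0) (Subtype.ext ?_))
      exact map_one Ψ)
    (by
      intro m n a b
      induction a using Submodule.Quotient.induction_on with
      | _ a =>
      induction b using Submodule.Quotient.induction_on with
      | _ b =>
      refine Eq.trans ?_ (filB.symbol_mul ⟨Ψ a.1, h m _ a.2⟩ ⟨Ψ b.1, h n _ b.2⟩).symm
      exact congrArg (filB.symbol (m + n)) (Subtype.ext (map_mul Ψ a.1 b.1)))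

theorem map_symbol (Ψ : A →ₐ[K] B) (h : ∀ n a, a ∈ fil.F n → Ψ a ∈ filB.F n) {n : ℕ}
    (a : ↥(fil.F n)) : map Ψ h (fil.symbol n a) = filB.symbol n ⟨Ψ a.1, h n _ a.2⟩ :=
  DirectSum.toAddMonoid_of _ _ _

theorem gr_algHom_ext {D : Type*} [Semiring D] [Algebra K D] {f g : fil.gr →ₐ[K] D}
    (h : ∀ n a, f (fil.symbol n a) = g (fil.symbol n a)) : f = g := by
  refine DirectSum.algHom_ext _ _ fun n a => ?_
  induction a using Submodule.Quotient.induction_on with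
  | _ a => exact h n a

theorem map_id : map (AlgHom.id K A) (fun _ _ ha => ha) = AlgHom.id K fil.gr :=
  gr_algHom_ext fun _ a => map_symbol _ _ a

theorem map_comp (Ψ : A →ₐ[K] B) (h : ∀ n a, a ∈ fil.F n → Ψ a ∈ filB.F n) (Θ : B →ₐ[K] C)
    (h' : ∀ n a, a ∈ filB.F n → Θ a ∈ filC.F n)
    (h'' : ∀ n a, a ∈ fil.F n → Θ.comp Ψ a ∈ filC.F n) :
    map (Θ.comp Ψ) h'' = (map Θ h').comp (map Ψ h) :=
  gr_algHom_ext fun n a => by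
    rw [AlgHom.comp_apply, map_symbol, map_symbol, map_symbol]
    rfl

end Map

end AlgFiltration

/-! ### Color Lie algebras and their second scalar cohomology -/

variable {K : Type u} [Field K] {G : Type w} [AddCommGroup G] (ε : G → G → Kˣ)
  {V : Type v} [AddCommGroup V] [Module K V] (𝒱 : G → Submodule K V)

/-- An `ε`-Lie algebra structure (color Lie algebra structure) on the `G`-graded space `V`. -/
@[ext] structure LieStr where
  bracket : V →ₗ[K] V →ₗ[K] V
  graded : ∀ {g h : G} {x y : V}, x ∈ 𝒱 g → y ∈ 𝒱 h → bracket x y ∈ 𝒱 (g + h)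
  skew : ∀ {g h : G} {x y : V}, x ∈ 𝒱 g → y ∈ 𝒱 h → bracket x y = -(ε g h • bracket y x)
  jacobi : ∀ {g h k : G} {x y z : V}, x ∈ 𝒱 g → y ∈ 𝒱 h → z ∈ 𝒱 k →
    ε k g • bracket x (bracket y z) + ε g h • bracket y (bracket z x)
      + ε h k • bracket z (bracket x y) = 0

variable {ε 𝒱}

/-- Scalar 1-cochains of degree zero: linear forms on `V` that are graded, `K` being
concentrated in degree `0`. -/
def cochain1 (𝒱 : G → Submodule K V) : Submodule K (V →ₗ[K] K) where
  carrier := {f | ∀ g x, x ∈ 𝒱 g → g ≠ 0 → f x = 0}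
  zero_mem' _ _ _ _ := rfl
  add_mem' {f f'} hf hf' g x hx hg := by
    rw [LinearMap.add_apply, hf g x hx hg, hf' g x hx hg, add_zero]
  smul_mem' c f hf g x hx hg := by rw [LinearMap.smul_apply, hf g x hx hg, smul_zero]

namespace LieStr

variable (L : LieStr ε 𝒱)

/-- Scalar graded 2-cocycles of degree zero: `ε`-skew-symmetric bilinear forms of degree zero
that satisfy the cocycle identity. -/
def Z2 : Submodule K (V →ₗ[K] V →ₗ[K] K) where
  carrier := {ω |
    (∀ g h x y, x ∈ 𝒱 g → y ∈ 𝒱 h → g + h ≠ 0 → ω x y = 0) ∧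
    (∀ g h x y, x ∈ 𝒱 g → y ∈ 𝒱 h → ω x y = -(ε g h • ω y x)) ∧
    (∀ g h k x y z, x ∈ 𝒱 g → y ∈ 𝒱 h → z ∈ 𝒱 k →
      ε k g • ω x (L.bracket y z) + ε g h • ω y (L.bracket z x)
        + ε h k • ω z (L.bracket x y) = 0)}
  zero_mem' := by simp
  add_mem' := by
    rintro ω ω' ⟨h1, h2, h3⟩ ⟨h1', h2', h3'⟩
    refine ⟨fun g h x y hx hy hgh => ?_, fun g h x y hx hy => ?_,
      fun g h k x y z hx hy hz => ?_⟩
    · simp [h1 g h x y hx hy hgh, h1' g h x y hx hy hgh]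
    · simp only [LinearMap.add_apply]
      rw [h2 g h x y hx hy, h2' g h x y hx hy, smul_add]
      abel
    · have e := h3 g h k x y z hx hy hz
      have e' := h3' g h k x y z hx hy hz
      simp only [LinearMap.add_apply, smul_add]
      rw [← add_zero (0 : K)]
      nth_rewrite 1 [← e]
      rw [← e']
      abel
  smul_mem' := by
    rintro c ω ⟨h1, h2, h3⟩
    refine ⟨fun g h x y hx hy hgh => ?_, fun g h x y hx hy => ?_,
      fun g h k x y z hx hy hz => ?_⟩
    · simp [h1 g h x y hx hy hgh]
    · simp only [LinearMap.smul_apply]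
      rw [h2 g h x y hx hy, smul_neg, smul_comm]
    · have e := h3 g h k x y z hx hy hz
      simp only [LinearMap.smul_apply]
      rw [smul_comm _ c, smul_comm _ c, smul_comm _ c, ← smul_add, ← smul_add, e, smul_zero]

/-- The coboundary of a scalar 1-cochain: `(δ f)(x, y) = -f([x, y])`. -/
def coboundary : (V →ₗ[K] K) →ₗ[K] (V →ₗ[K] V →ₗ[K] K) where
  toFun f := -(L.bracket.compr₂ f)
  map_add' f f' := by
    ext x y
    simp
    ring
  map_smul' c f := by
    ext x y
    simp

/-- Scalar graded 2-coboundaries of degree zero. -/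
def B2 : Submodule K (V →ₗ[K] V →ₗ[K] K) := (cochain1 𝒱).map L.coboundary

theorem B2_le_Z2 : L.B2 ≤ L.Z2 := by
  rintro _ ⟨f, hf, rfl⟩
  refine ⟨fun g h x y hx hy hgh => ?_, fun g h x y hx hy => ?_,
    fun g h k x y z hx hy hz => ?_⟩
  · simp [coboundary, hf _ _ (L.graded hx hy) hgh]
  · simp only [coboundary, LinearMap.coe_mk, AddHom.coe_mk, LinearMap.neg_apply,
      LinearMap.compr₂_apply, Units.smul_def]
    rw [L.skew hx hy, Units.smul_def, map_neg, map_smul, smul_neg]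
  · have e := congrArg f (L.jacobi hx hy hz)
    simp only [coboundary, LinearMap.coe_mk, AddHom.coe_mk, LinearMap.neg_apply,
      LinearMap.compr₂_apply, Units.smul_def, smul_neg]
    simp only [Units.smul_def, map_add, map_smul, map_zero] at e
    rw [← neg_add, ← neg_add, e, neg_zero]

/-- The second graded cohomology group `H²_gr(L, K)` of degree zero. -/
abbrev H2 : Type (max u v) := ↥L.Z2 ⧸ L.B2.submoduleOf L.Z2

/-- The cohomology class of a cocycle. -/
def classOf (ω : ↥L.Z2) : L.H2 := Submodule.Quotient.mk ω

end LieStr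

/-! ### The `ε`-symmetric algebra and the generalized enveloping algebras -/

/-- The span of the products `i(x₁) ⋯ i(xₙ)` of homogeneous elements of `V` whose length `n` and
whose total degree `|x₁| + ⋯ + |xₙ|` satisfy `P`. -/
def wordSpan (𝒱 : G → Submodule K V) {A : Type t} [Ring A] [Algebra K A] (i : V →ₗ[K] A)
    (P : ℕ → G → Prop) : Submodule K A :=
  Submodule.span K {a | ∃ l : List (Σ g, ↥(𝒱 g)),
    P l.length (l.map Sigma.fst).sum ∧ (l.map fun p => i (p.2 : V)).prod = a}

theorem mul_mem_wordSpan {A : Type t} [Ring A] [Algebra K A] {i : V →ₗ[K] A}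
    {P Q R : ℕ → G → Prop} (h : ∀ m n g g', P m g → Q n g' → R (m + n) (g + g')) {a b : A}
    (ha : a ∈ wordSpan 𝒱 i P) (hb : b ∈ wordSpan 𝒱 i Q) : a * b ∈ wordSpan 𝒱 i R := by
  have hab := Submodule.mul_mem_mul ha hb
  rw [wordSpan, wordSpan, Submodule.span_mul_span] at hab
  refine Submodule.span_mono ?_ hab
  rintro _ ⟨_, ⟨l, hl, rfl⟩, _, ⟨l', hl', rfl⟩, rfl⟩
  refine ⟨l ++ l', ?_, by simp⟩
  simpa using h _ _ _ _ hl hl'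

variable (ε 𝒱) in
/-- The relations `x ⊗ y = ε(|x|, |y|) y ⊗ x`, for homogeneous `x`, `y`. -/
inductive SymRel : TensorAlgebra K V → TensorAlgebra K V → Prop
  | comm {g h : G} {x y : V} (hx : x ∈ 𝒱 g) (hy : y ∈ 𝒱 h) :
      SymRel (TensorAlgebra.ι K x * TensorAlgebra.ι K y)
        (ε g h • (TensorAlgebra.ι K y * TensorAlgebra.ι K x))

variable (ε 𝒱) in
/-- The `ε`-symmetric algebra `S(V)`. -/
abbrev SymAlg : Type (max u v) := RingQuot (SymRel ε 𝒱)

variable (ε 𝒱) in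
/-- The canonical map `V → S(V)`. -/
def symι : V →ₗ[K] SymAlg ε 𝒱 :=
  (RingQuot.mkAlgHom K (SymRel ε 𝒱)).toLinearMap.comp (TensorAlgebra.ι K)

variable (ε 𝒱) in
/-- The component of degree `(n, g)` of `S(V)`. -/
def symPiece (n : ℕ) (g : G) : Submodule K (SymAlg ε 𝒱) :=
  wordSpan 𝒱 (symι ε 𝒱) fun m g' => m = n ∧ g' = g

namespace LieStr

variable (L : LieStr ε 𝒱) (ω : ↥L.Z2)

/-- The relations `x ⊗ y - ε(|x|, |y|) y ⊗ x = [x, y] + ω(x, y)`, for homogeneous `x`, `y`. -/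
inductive EnvRel : TensorAlgebra K V → TensorAlgebra K V → Prop
  | comm {g h : G} {x y : V} (hx : x ∈ 𝒱 g) (hy : y ∈ 𝒱 h) :
      EnvRel
        (TensorAlgebra.ι K x * TensorAlgebra.ι K y
          - ε g h • (TensorAlgebra.ι K y * TensorAlgebra.ι K x))
        (TensorAlgebra.ι K (L.bracket x y) + algebraMap K _ (ω.1 x y))

/-- The generalized enveloping algebra `U_ω(L)`. -/
abbrev Env : Type (max u v) := RingQuot (L.EnvRel ω)

/-- The canonical map `i_ω : L → U_ω(L)`. -/
def envι : V →ₗ[K] L.Env ω :=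
  (RingQuot.mkAlgHom K (L.EnvRel ω)).toLinearMap.comp (TensorAlgebra.ι K)

theorem envι_comm {g h : G} {x y : V} (hx : x ∈ 𝒱 g) (hy : y ∈ 𝒱 h) :
    L.envι ω x * L.envι ω y - ε g h • (L.envι ω y * L.envι ω x)
      = L.envι ω (L.bracket x y) + algebraMap K _ (ω.1 x y) := by
  have e := RingQuot.mkAlgHom_rel K (EnvRel.comm (L := L) (ω := ω) hx hy)
  simp only [map_sub, map_mul, map_add, Units.smul_def, map_smul, AlgHom.commutes] at e
  exact e

/-- The `G`-grading of `U_ω(L)`. -/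
def envGrading (g : G) : Submodule K (L.Env ω) :=
  wordSpan 𝒱 (L.envι ω) fun _ g' => g' = g

/-- The canonical filtration of `U_ω(L)`: the `n`-th step is the image of the tensors of
order `≤ n`. -/
def envFiltration : AlgFiltration K (L.Env ω) where
  F n := wordSpan 𝒱 (L.envι ω) fun m _ => m ≤ n
  mono n n' hn := Submodule.span_mono fun _ ⟨l, hl, e⟩ => ⟨l, hl.trans hn, e⟩
  one_mem := Submodule.subset_span ⟨[], by simp⟩
  mul_mem ha hb := mul_mem_wordSpan (fun _ _ _ _ h h' => Nat.add_le_add h h') ha hb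

variable [DecidableEq G] [DirectSum.Decomposition 𝒱]

theorem envι_mem (x : V) : L.envι ω x ∈ (L.envFiltration ω).F 1 := by
  classical
  rw [← DirectSum.sum_support_decompose 𝒱 x, map_sum]
  exact Submodule.sum_mem _ fun g _ =>
    Submodule.subset_span ⟨[⟨g, DirectSum.decompose 𝒱 x g⟩], by simp⟩

/-- The map `L → F₁ U_ω(L) → F₁ U_ω(L) / F₀ U_ω(L) ⊆ gr(U_ω(L))`. -/
def envSymbol : V →ₗ[K] (L.envFiltration ω).gr :=
  ((L.envFiltration ω).symbol 1).comp ((L.envι ω).codRestrict _ (L.envι_mem ω))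

theorem envSymbol_comm {g h : G} {x y : V} (hx : x ∈ 𝒱 g) (hy : y ∈ 𝒱 h) :
    L.envSymbol ω x * L.envSymbol ω y = ε g h • (L.envSymbol ω y * L.envSymbol ω x) := by
  have key := (L.envFiltration ω).symbol_eq (n := 1 + 1)
    (a := ⟨L.envι ω x * L.envι ω y,
      (L.envFiltration ω).mul_mem (L.envι_mem ω x) (L.envι_mem ω y)⟩)
    (b := (ε g h : K) • ⟨L.envι ω y * L.envι ω x,
      (L.envFiltration ω).mul_mem (L.envι_mem ω y) (L.envι_mem ω x)⟩)
    (by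
      change L.envι ω x * L.envι ω y - ε g h • (L.envι ω y * L.envι ω x) ∈ _
      rw [L.envι_comm ω hx hy]
      exact Submodule.add_mem _ (L.envι_mem ω _)
        ((L.envFiltration ω).mono zero_le_one ((L.envFiltration ω).algebraMap_mem _)))
  rw [map_smul] at key
  change (L.envFiltration ω).symbol 1 _ * (L.envFiltration ω).symbol 1 _
    = ε g h • ((L.envFiltration ω).symbol 1 _ * (L.envFiltration ω).symbol 1 _)
  rw [AlgFiltration.symbol_mul, AlgFiltration.symbol_mul]
  exact key

/-- The canonical homomorphism `φ_ω : S(V) → gr(U_ω(L))`, the unique algebra homomorphism that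
extends `L → gr(U_ω(L))`. -/
def envφ : SymAlg ε 𝒱 →ₐ[K] (L.envFiltration ω).gr :=
  RingQuot.liftAlgHom K ⟨TensorAlgebra.lift K (L.envSymbol ω), by
    rintro _ _ ⟨hx, hy⟩
    simpa [Units.smul_def] using L.envSymbol_comm ω hx hy⟩

theorem envφ_symι (x : V) : L.envφ ω (symι ε 𝒱 x) = L.envSymbol ω x := by
  simp [envφ, symι]

end LieStr

/-! ### The category of filtered graded algebras with associated graded algebra `S(V)` -/

variable (ε 𝒱) in
/-- The raw data of a pair `(A, φ_A)`: an algebra `A` with a family of subspaces indexed by `G`, a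
positive filtration, and an algebra homomorphism `φ_A : S(V) → gr(A)`. -/
structure PreModel where
  carrier : Type t
  [ring : Ring carrier]
  [algebra : Algebra K carrier]
  grading : G → Submodule K carrier
  fil : AlgFiltration K carrier
  φ : SymAlg ε 𝒱 →ₐ[K] fil.gr

namespace PreModel

attribute [instance] PreModel.ring PreModel.algebra

/-- The data `(A, φ_A)` form a `G`-graded, positively filtered algebra (with an exhaustive
filtration by graded subspaces) and a `G × ℤ`-graded isomorphism `φ_A : S(V) ≅ gr(A)`. -/
structure IsObject [DecidableEq G] (A : PreModel.{u, v, w, t} ε 𝒱) : Prop where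
  gradedMonoid : SetLike.GradedMonoid A.grading
  isInternal : DirectSum.IsInternal A.grading
  exhaustive : ∀ a : A.carrier, ∃ n, a ∈ A.fil.F n
  homogeneous : ∀ n, A.fil.F n ≤ ⨆ g, A.fil.F n ⊓ A.grading g
  bijective : Function.Bijective A.φ
  graded : ∀ n g s, s ∈ symPiece ε 𝒱 n g ↔ A.φ s ∈ A.fil.grPiece A.grading n g

/-- Maps `(A, φ_A) → (B, φ_B)`: homomorphisms `Ψ` of `G`-graded, filtered algebras with
`gr(Ψ) ∘ φ_A = φ_B`. -/
@[ext] structure Hom (A B : PreModel.{u, v, w, t} ε 𝒱) where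
  Ψ : A.carrier →ₐ[K] B.carrier
  map_grading : ∀ g a, a ∈ A.grading g → Ψ a ∈ B.grading g
  map_fil : ∀ n a, a ∈ A.fil.F n → Ψ a ∈ B.fil.F n
  comm : (AlgFiltration.map Ψ map_fil).comp A.φ = B.φ

end PreModel

variable (ε 𝒱) in
/-- The objects `(A, φ_A)`. -/
structure Model [DecidableEq G] extends PreModel.{u, v, w, t} ε 𝒱 where
  isObject : toPreModel.IsObject

/-- The category of `G`-graded, positively filtered algebras `A` with a graded isomorphism
`S(V) ≅ gr(A)`. -/
instance Model.category [DecidableEq G] : CategoryTheory.Category (Model.{u, v, w, t} ε 𝒱) where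
  Hom A B := PreModel.Hom A.toPreModel B.toPreModel
  id A :=
    { Ψ := AlgHom.id K A.carrier
      map_grading := fun _ _ ha => ha
      map_fil := fun _ _ ha => ha
      comm := by rw [AlgFiltration.map_id]; rfl }
  comp {A B C} f g :=
    { Ψ := g.Ψ.comp f.Ψ
      map_grading := fun i a ha => g.map_grading i _ (f.map_grading i a ha)
      map_fil := fun n a ha => g.map_fil n _ (f.map_fil n a ha)
      comm := by
        have e := AlgFiltration.map_comp f.Ψ f.map_fil g.Ψ g.map_fil
          (fun n a ha => g.map_fil n _ (f.map_fil n a ha))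
        refine (congrArg (fun Θ => Θ.comp A.φ) e).trans ?_
        rw [AlgHom.comp_assoc, f.comm, g.comm] }

variable (ε 𝒱) in
/-- The isomorphism classes of objects `(A, φ_A)`. -/
abbrev Model.IsoClasses [DecidableEq G] : Type _ :=
  Quotient (CategoryTheory.isIsomorphicSetoid (Model.{u, v, w, t} ε 𝒱))

/-- The isomorphism class of an object. -/
def Model.isoClass [DecidableEq G] (A : Model.{u, v, w, t} ε 𝒱) :
    Model.IsoClasses.{u, v, w, t} ε 𝒱 :=
  Quotient.mk _ A

/-- The pair `(U_ω(L), φ_ω)`. -/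
def LieStr.env [DecidableEq G] [DirectSum.Decomposition 𝒱] (L : LieStr ε 𝒱) (ω : ↥L.Z2) :
    PreModel.{u, v, w, max u v} ε 𝒱 where
  carrier := L.Env ω
  grading := L.envGrading ω
  fil := L.envFiltration ω
  φ := L.envφ ω

end ColorLie

end

/-!
The pair `(U_ω(L), φ_ω)` is an object by a Poincaré–Birkhoff–Witt theorem, and every object is of
this form because its first filtration step generates it and carries a bracket and a cocycle.

**Poincaré–Birkhoff–Witt.** Fix a homogeneous basis of `V` and the words in it, which form a basis
of `T(V)`. The point is that a combination of defining relations whose terms of highest order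
cancel is a combination of relations of lower order (`relSpan_succ_inf_tensorLE`,
`mem_relSpan_of_mem_tensorLE`); this gives the injectivity of `φ_ω` (`envφ_injective`). In
characteristic zero it can be proved without an order on the basis, by symmetrization. Modulo the
relations, a word is the sum of its `ε`-symmetrization and of an explicit tensor of lower order,
`straighten`, which is defined by recursion: average over the letter that is pulled to the front,
collect the terms that arise on the way (`exchSum`), and straighten the rest. Since the
`ε`-symmetrization does not see the order of the letters up to sign, exchanging two neighbours
should change `straighten` by the right-hand side `[x, y] + ω(x, y)` of the relation alone. That it
does so modulo relations of lower order (`exchSum_swap_mem`, `straighten_swap_mem`) is where the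
Jacobi and cocycle identities enter, in the form of `overlap_eq`. Hence the linear map of `T(V)`
that straightens the words of length `n + 1` and fixes the shorter ones lowers the order of
relations and fixes the tensors of order at most `n`.

The components of `U_ω(L)` are independent because the grading comes from a coaction of the group
algebra of `G` (`exists_coaction`), and `φ_ω` matches the bigraded pieces since taking leading
parts of tensors is compatible with degrees (`symbol_envMk`). Together this is `env_isObject`.

**The classification.** A map `Ψ` of objects has bijective `gr(Ψ)`, so by induction on the
filtration it is an isomorphism (`Hom.exists_inverse`); isomorphism thus amounts to the existence
of one map. For an object `A`, the isomorphism `φ_A` in order one lifts to a graded linear map `i :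
V → F₁ A` (`IsObject.exists_isLift`), and `F₁ A` is the direct sum of `i(V)` and the scalars. As
`gr(A)` is `ε`-commutative, the `ε`-commutators of values of `i` lie in `F₁ A`, and their two
components are an `ε`-Lie bracket and a cocycle (`IsLift.exists_satisfies`), so that `i` induces a
map from `U_ω(L)` to `A` (`IsLift.exists_hom`). Two lifts differ by a graded linear form
(`IsLift.exists_cochain`), which leaves the `ε`-commutators unchanged (`commutator_add_cochain`),
and therefore leaves the bracket unchanged and changes the cocycle by a coboundary
(`IsLift.eq_of_satisfies`).
-/

noncomputable section

namespace ColorLie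

/-! ### Signed sums over the letters of a word -/

section PullSum

variable {K : Type u} [Field K] {B : Type*} {M : Type*} [AddCommGroup M] [Module K M]
  {N : Type*} [AddCommGroup N] [Module K N]

/-- `pullSum e l f` is the sum, over the letters `i` of the word `l`, of `± f i r`, where `r` is `l`
without that letter and the sign `±` is the product of the `e a i` over the letters `a` in front
of it, which `i` passes on its way to the front of the word. -/
def pullSum (e : B → B → K) : List B → (B → List B → M) → M
  | [], _ => 0
  | a :: l, f => f a l + pullSum e l fun i r => e a i • f i (a :: r)

/-- The variant of `pullSum` for a word `u ⬝ v` with a hole between `u` and `v`, which the letter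
`i` passes at the cost of the sign `h i`; the letters come from `u` and `v` only. -/
def pullSum₂ (e : B → B → K) (h : B → K) :
    List B → List B → (B → List B → List B → M) → M
  | [], v, f => pullSum e v fun i r => h i • f i [] r
  | d :: u, v, f => f d u v + pullSum₂ e h u v fun i u' v' => e d i • f i (d :: u') v'

variable {e : B → B → K} {h : B → K}

theorem map_pullSum (φ : M →ₗ[K] N) (l : List B) (f : B → List B → M) :
    φ (pullSum e l f) = pullSum e l fun i r => φ (f i r) := by
  induction l generalizing f with
  | nil => simp [pullSum]
  | cons a l ih => simp [pullSum, ih]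

theorem pullSum_add (l : List B) (f g : B → List B → M) :
    pullSum e l f + pullSum e l g = pullSum e l fun i r => f i r + g i r := by
  induction l generalizing f g with
  | nil => simp [pullSum]
  | cons a l ih =>
    simp only [pullSum, smul_add, ← ih]
    abel

theorem pullSum_smul (c : K) (l : List B) (f : B → List B → M) :
    c • pullSum e l f = pullSum e l fun i r => c • f i r :=
  map_pullSum (LinearMap.lsmul K M c) l f

theorem pullSum_neg (l : List B) (f : B → List B → M) :
    -pullSum e l f = pullSum e l fun i r => -f i r :=
  map_pullSum (-LinearMap.id : M →ₗ[K] M) l f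

theorem pullSum_sub (l : List B) (f g : B → List B → M) :
    pullSum e l f - pullSum e l g = pullSum e l fun i r => f i r - g i r := by
  simp only [sub_eq_add_neg, pullSum_neg, pullSum_add]

theorem pullSum_mem (S : Submodule K M) {l : List B} {f : B → List B → M}
    (hf : ∀ i r, r.length + 1 = l.length → f i r ∈ S) : pullSum e l f ∈ S := by
  induction l generalizing f with
  | nil => exact S.zero_mem
  | cons a l ih =>
    exact S.add_mem (hf _ _ rfl) (ih fun i r hr => S.smul_mem _ (hf _ _ (by simp [hr])))

theorem map_pullSum₂ (φ : M →ₗ[K] N) (u v : List B) (f : B → List B → List B → M) :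
    φ (pullSum₂ e h u v f) = pullSum₂ e h u v fun i u' v' => φ (f i u' v') := by
  induction u generalizing f with
  | nil => simp [pullSum₂, map_pullSum]
  | cons d u ih => simp [pullSum₂, ih]

theorem pullSum₂_add (u v : List B) (f g : B → List B → List B → M) :
    pullSum₂ e h u v f + pullSum₂ e h u v g
      = pullSum₂ e h u v fun i u' v' => f i u' v' + g i u' v' := by
  induction u generalizing f g with
  | nil => simp only [pullSum₂, smul_add, pullSum_add]
  | cons d u ih =>
    simp only [pullSum₂, smul_add, ← ih]
    abel

theorem pullSum₂_sub (u v : List B) (f g : B → List B → List B → M) :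
    pullSum₂ e h u v f - pullSum₂ e h u v g
      = pullSum₂ e h u v fun i u' v' => f i u' v' - g i u' v' := by
  have hg : -pullSum₂ e h u v g = pullSum₂ e h u v fun i u' v' => -g i u' v' :=
    map_pullSum₂ (-LinearMap.id : M →ₗ[K] M) u v g
  rw [sub_eq_add_neg, hg, pullSum₂_add]
  simp only [sub_eq_add_neg]

theorem pullSum₂_mem (S : Submodule K M) {u v : List B} {f : B → List B → List B → M}
    (hf : ∀ i u' v', u'.length + v'.length + 1 = u.length + v.length → f i u' v' ∈ S) :
    pullSum₂ e h u v f ∈ S := by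
  induction u generalizing f with
  | nil => exact pullSum_mem S fun i r hr => S.smul_mem _ (hf _ _ _ (by simpa using hr))
  | cons d u ih =>
    refine S.add_mem (hf _ _ _ (by simp; omega)) (ih fun i u' v' hl => S.smul_mem _ (hf _ _ _ ?_))
    simp only [List.length_cons]
    omega

/-- Exchanging two neighbouring letters `a`, `b` leaves the terms in which `a` or `b` is pulled out
unchanged up to the factor `e a b`, so that only the other letters contribute to the difference. -/
theorem pullSum_swap {a b : B} (hab : e a b * e b a = 1) (u v : List B) (f : B → List B → M) :
    pullSum e (u ++ a :: b :: v) f - e a b • pullSum e (u ++ b :: a :: v) f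
      = pullSum₂ e (fun i => e a i * e b i) u v fun i u' v' =>
          f i (u' ++ a :: b :: v') - e a b • f i (u' ++ b :: a :: v') := by
  induction u generalizing f with
  | nil =>
    simp only [List.nil_append, pullSum, pullSum₂, smul_add, smul_smul, hab, one_smul, smul_sub,
      ← pullSum_sub, pullSum_smul]
    have h1 : ∀ i, e b i * e a i = e a i * e b i := fun i => mul_comm _ _
    have h2 : ∀ i, e a b * (e a i * e b i) = e a i * e b i * e a b := fun i => mul_comm _ _
    simp only [h1, h2]
    abel
  | cons d u ih =>
    simp only [List.cons_append, pullSum, pullSum₂, smul_add]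
    have := ih fun i r => e d i • f i (d :: r)
    rw [add_sub_add_comm, this]
    simp only [smul_sub, smul_comm (e a b)]

end PullSum

/-! ### The relations of the enveloping algebra inside the tensor algebra -/

section Relations

variable {K : Type u} [Field K] {G : Type w} [AddCommGroup G] {ε : G → G → Kˣ}
  {V : Type v} [AddCommGroup V] [Module K V] {𝒱 : G → Submodule K V}

open TensorAlgebra (ι)

variable (𝒱) in
/-- The tensors of order at most `n`. -/
def tensorLE (n : ℕ) : Submodule K (TensorAlgebra K V) :=
  wordSpan 𝒱 (ι K) fun m _ => m ≤ n

theorem tensorLE_mul {p q n : ℕ} (h : p + q ≤ n) {a c : TensorAlgebra K V} (ha : a ∈ tensorLE 𝒱 p)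
    (hc : c ∈ tensorLE 𝒱 q) : a * c ∈ tensorLE 𝒱 n := by
  unfold tensorLE at *
  refine mul_mem_wordSpan (P := fun m _ => m ≤ p) (Q := fun m _ => m ≤ q) ?_ ha hc
  intro m m' _ _ h₁ h₂
  omega

theorem tensorLE_mono {m n : ℕ} (h : m ≤ n) : tensorLE 𝒱 m ≤ tensorLE 𝒱 n :=
  Submodule.span_mono fun _ ⟨l, hl, e⟩ => ⟨l, hl.trans h, e⟩

theorem algebraMap_mem_tensorLE (c : K) (n : ℕ) :
    algebraMap K (TensorAlgebra K V) c ∈ tensorLE 𝒱 n := by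
  rw [Algebra.algebraMap_eq_smul_one]
  exact Submodule.smul_mem _ _ (Submodule.subset_span ⟨[], by simp⟩)

theorem ι_mem_tensorLE_of_mem {g : G} {x : V} (hx : x ∈ 𝒱 g) : ι K x ∈ tensorLE 𝒱 1 :=
  Submodule.subset_span ⟨[⟨g, x, hx⟩], by simp⟩

theorem ι_mem_tensorLE [DecidableEq G] [DirectSum.Decomposition 𝒱] (x : V) :
    ι K x ∈ tensorLE 𝒱 1 := by
  classical
  rw [← DirectSum.sum_support_decompose 𝒱 x, map_sum]
  exact Submodule.sum_mem _ fun g _ => ι_mem_tensorLE_of_mem (SetLike.coe_mem _)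

/-- A scalar of degree `g + h` is not affected by the sign `ε(k, g + h)`: it vanishes unless
`g + h = 0`. -/
theorem IsBicharacter.mul_eq_of_degree_eq_zero (hε : IsBicharacter ε) {g h : G} (k : G) {c : K}
    (hc : g + h ≠ 0 → c = 0) : c * (ε k g * ε k h) = c := by
  by_cases hgh : g + h = 0
  · have h1 : ε k 0 = 1 := by
      have := hε.add_right k 0 0
      rw [add_zero] at this
      exact mul_eq_left.1 this.symm
    rw [← Units.val_mul, ← hε.add_right, hgh, h1, Units.val_one, mul_one]
  · rw [hc hgh, zero_mul]

namespace LieStr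

variable (L : LieStr ε 𝒱) (ω : ↥L.Z2)

/-- The right-hand side `[x, y] + ω(x, y)` of the defining relations of `U_ω(L)`, as a tensor of
order at most `1`. -/
def corr : V →ₗ[K] V →ₗ[K] TensorAlgebra K V :=
  L.bracket.compr₂ (ι K) + ω.1.compr₂ (Algebra.linearMap K _)

theorem corr_apply (x y : V) : L.corr ω x y = ι K (L.bracket x y) + algebraMap K _ (ω.1 x y) := rfl

/-- The defining relation `x ⊗ y - c y ⊗ x - [x, y] - ω(x, y)`, bilinear in `x` and `y`, with an
arbitrary scalar `c` in place of `ε(|x|, |y|)`. -/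
def relator (c : K) (x y : V) : TensorAlgebra K V :=
  ι K x * ι K y - c • (ι K y * ι K x) - L.corr ω x y

/-- The span of the products `a ⊗ r ⊗ c` of total order at most `m`, where `r` is a defining
relation of `U_ω(L)`. The union over `m` is the defining ideal. -/
def relSpan (m : ℕ) : Submodule K (TensorAlgebra K V) :=
  Submodule.span K {t | ∃ (g h : G) (x y : V) (a c : TensorAlgebra K V) (p q : ℕ),
    x ∈ 𝒱 g ∧ y ∈ 𝒱 h ∧ a ∈ tensorLE 𝒱 p ∧ c ∈ tensorLE 𝒱 q ∧ p + q + 2 ≤ m ∧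
      a * L.relator ω (ε g h) x y * c = t}

variable {L ω}

theorem relSpan_mono {m n : ℕ} (h : m ≤ n) : L.relSpan ω m ≤ L.relSpan ω n :=
  Submodule.span_mono fun _ ⟨g, k, x, y, a, c, p, q, hx, hy, ha, hc, hpq, e⟩ =>
    ⟨g, k, x, y, a, c, p, q, hx, hy, ha, hc, hpq.trans h, e⟩

theorem mul_mem_relSpan {k m n : ℕ} (hkm : k + m ≤ n) {a t : TensorAlgebra K V}
    (ha : a ∈ tensorLE 𝒱 k) (ht : t ∈ L.relSpan ω m) : a * t ∈ L.relSpan ω n := by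
  have : L.relSpan ω m ≤ (L.relSpan ω n).comap (LinearMap.mulLeft K a) := by
    refine Submodule.span_le.2 ?_
    rintro _ ⟨g, h, x, y, a', c, p, q, hx, hy, ha', hc, hpq, rfl⟩
    refine Submodule.subset_span ⟨g, h, x, y, a * a', c, k + p, q, hx, hy,
      tensorLE_mul le_rfl ha ha', hc, by omega, ?_⟩
    simp [mul_assoc]
  exact this ht

theorem relSpan_mul_mem {k m n : ℕ} (hkm : m + k ≤ n) {t c : TensorAlgebra K V}
    (ht : t ∈ L.relSpan ω m) (hc : c ∈ tensorLE 𝒱 k) : t * c ∈ L.relSpan ω n := by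
  have : L.relSpan ω m ≤ (L.relSpan ω n).comap (LinearMap.mulRight K c) := by
    refine Submodule.span_le.2 ?_
    rintro _ ⟨g, h, x, y, a', c', p, q, hx, hy, ha', hc', hpq, rfl⟩
    refine Submodule.subset_span ⟨g, h, x, y, a', c' * c, p, q + k, hx, hy,
      ha', tensorLE_mul le_rfl hc' hc, by omega, ?_⟩
    simp [mul_assoc]
  exact this ht

theorem relator_mem_relSpan {g h : G} {x y : V} (hx : x ∈ 𝒱 g) (hy : y ∈ 𝒱 h) :
    L.relator ω (ε g h) x y ∈ L.relSpan ω 2 :=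
  Submodule.subset_span ⟨g, h, x, y, 1, 1, 0, 0, hx, hy, Submodule.subset_span ⟨[], by simp⟩,
    Submodule.subset_span ⟨[], by simp⟩, by simp⟩

theorem relator_mul_mem {g h : G} {x y : V} (hx : x ∈ 𝒱 g) (hy : y ∈ 𝒱 h) {m n : ℕ}
    (hmn : m + 2 ≤ n) {c : TensorAlgebra K V} (hc : c ∈ tensorLE 𝒱 m) :
    L.relator ω (ε g h) x y * c ∈ L.relSpan ω n :=
  relSpan_mul_mem (by omega) (relator_mem_relSpan hx hy) hc

theorem corr_mem [DecidableEq G] [DirectSum.Decomposition 𝒱] (x y : V) :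
    L.corr ω x y ∈ tensorLE 𝒱 1 :=
  Submodule.add_mem _ (ι_mem_tensorLE _) (algebraMap_mem_tensorLE _ _)

theorem corr_skew {g h : G} {x y : V} (hx : x ∈ 𝒱 g) (hy : y ∈ 𝒱 h) :
    L.corr ω x y = -((ε g h : K) • L.corr ω y x) := by
  rw [corr_apply, corr_apply, L.skew hx hy, ω.2.2.1 g h x y hx hy]
  simp only [Units.smul_def, map_neg, map_smul, smul_add, Algebra.algebraMap_eq_smul_one, neg_add,
    smul_smul, smul_eq_mul]

/-- The Leibniz form of the Jacobi identity and of the cocycle identity. -/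
theorem corr_leibniz (hε : IsBicharacter ε) {g h k : G} {x y z : V} (hx : x ∈ 𝒱 g) (hy : y ∈ 𝒱 h)
    (hz : z ∈ 𝒱 k) :
    L.corr ω x (L.bracket y z) - (ε g h : K) • L.corr ω y (L.bracket x z)
      = L.corr ω (L.bracket x y) z := by
  have h1 : (ε k g : K) * ε g k = 1 := by rw [← Units.val_mul, hε.antisymm, Units.val_one]
  have h2 : (ε h k : K) * ε k h = 1 := by rw [← Units.val_mul, hε.antisymm, Units.val_one]
  have key : L.corr ω x (L.bracket y z)
      + ((ε g k : K) * ε g h) • L.corr ω y (L.bracket z x)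
      + ((ε g k : K) * ε h k) • L.corr ω z (L.bracket x y) = 0 := by
    have e1 := congrArg (ι K) (L.jacobi hx hy hz)
    have e2 := congrArg (algebraMap K (TensorAlgebra K V)) (ω.2.2.2 g h k x y z hx hy hz)
    have e3 := congrArg (fun t => (ε g k : K) • t) (congrArg₂ (· + ·) e1 e2)
    simp only [Units.smul_def, map_add, map_smul, map_zero, smul_zero, add_zero, smul_add,
      smul_eq_mul, map_mul, ← Algebra.smul_def, smul_smul, mul_comm (ε g k : K) (ε k g), h1,
      one_smul] at e3
    simp only [corr_apply, smul_add]
    rw [← e3]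
    abel
  rw [L.skew hz hx, corr_skew hz (L.graded hx hy)] at key
  simp only [Units.smul_def, map_neg, map_smul, smul_neg, smul_smul, hε.add_right, Units.val_mul]
    at key
  have c1 : (ε g k : K) * ε g h * ε k g = ε g h := by linear_combination (ε g h : K) * h1
  have c2 : (ε g k : K) * ε h k * (ε k g * ε k h) = 1 := by
    linear_combination (ε h k : K) * ε k h * h1 + h2
  rw [c1, c2, one_smul] at key
  rw [← sub_eq_zero, ← key]
  abel

/-- The overlap of the relations for three homogeneous vectors: by the Jacobi and cocycle
identities, the difference between the ways of reordering them is a combination of defining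
relations. -/
theorem overlap_eq (hε : IsBicharacter ε) {g h k : G} {x y z : V} (hx : x ∈ 𝒱 g) (hy : y ∈ 𝒱 h)
    (hz : z ∈ 𝒱 k) :
    ι K x * L.corr ω y z + (ε h k : K) • (L.corr ω x z * ι K y)
        - (ε g h : K) • (ι K y * L.corr ω x z)
        - ((ε g h : K) * ε g k) • (L.corr ω y z * ι K x)
        - L.corr ω x y * ι K z + ((ε g k : K) * ε h k) • (ι K z * L.corr ω x y)
      = L.relator ω (ε g (h + k)) x (L.bracket y z)
        - (ε g h : K) • L.relator ω (ε h (g + k)) y (L.bracket x z)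
        - L.relator ω (ε (g + h) k) (L.bracket x y) z := by
  have h1 : (ε g h : K) * ε h g = 1 := by rw [← Units.val_mul, hε.antisymm, Units.val_one]
  have w1 := hε.mul_eq_of_degree_eq_zero g (ω.2.1 h k y z hy hz)
  have w2 := hε.mul_eq_of_degree_eq_zero h (ω.2.1 g k x z hx hz)
  have w3 := hε.mul_eq_of_degree_eq_zero k (ω.2.1 g h x y hx hy)
  have h2 : (ε k g : K) * ε g k = 1 := by rw [← Units.val_mul, hε.antisymm, Units.val_one]
  have h3 : (ε h k : K) * ε k h = 1 := by rw [← Units.val_mul, hε.antisymm, Units.val_one]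
  have w3' : ω.1 x y * (ε g k * ε h k) = ω.1 x y := by
    linear_combination (-(ε g k : K) * ε h k) * w3 + ω.1 x y * (ε h k * ε k h * h2 + h3)
  have w2' : ω.1 x z * ε h k = ω.1 x z * ε g h := by
    linear_combination (ε g h : K) * w2 - ω.1 x z * ε h k * h1
  have hl := corr_leibniz (L := L) (ω := ω) hε hx hy hz
  simp only [relator, hε.add_right, hε.add_left, Units.val_mul]
  rw [← hl]
  simp only [L.corr_apply ω y z, L.corr_apply ω x z, L.corr_apply ω x y,
    Algebra.algebraMap_eq_smul_one, mul_add, add_mul, smul_add, smul_sub, mul_smul_comm,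
    smul_mul_assoc, mul_one, one_mul, smul_smul]
  match_scalars
  all_goals try ring1
  · linear_combination -w1
  · linear_combination -(ε h k : K) * h1
  · linear_combination w2'
  · linear_combination w3'

end LieStr
end Relations

/-! ### Straightening of words in a homogeneous basis -/

section Straightening

open TensorAlgebra (ι)

variable {K : Type u} [Field K] {G : Type w} [AddCommGroup G] {ε : G → G → Kˣ}
  {V : Type v} [AddCommGroup V] [Module K V] {𝒱 : G → Submodule K V}
  {B : Type*}

/-- The product in `T(V)` of a word in the vectors `b i`. -/
def vecWord (b : B → V) (l : List B) : TensorAlgebra K V :=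
  (l.map fun i => ι K (b i)).prod

@[simp] theorem vecWord_nil (b : B → V) : vecWord (K := K) b [] = 1 := rfl

@[simp] theorem vecWord_cons (b : B → V) (i : B) (l : List B) :
    vecWord (K := K) b (i :: l) = ι K (b i) * vecWord b l := by
  simp [vecWord]

@[simp] theorem vecWord_append (b : B → V) (l l' : List B) :
    vecWord (K := K) b (l ++ l') = vecWord b l * vecWord b l' := by
  simp [vecWord]

theorem vecWord_mem {b : B → V} {deg : B → G} (hb : ∀ i, b i ∈ 𝒱 (deg i)) {l : List B} {n : ℕ}
    (hl : l.length ≤ n) : vecWord b l ∈ tensorLE 𝒱 n := by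
  refine Submodule.subset_span ⟨l.map fun i => ⟨deg i, b i, hb i⟩, by simpa using hl, ?_⟩
  simp [vecWord, Function.comp_def]

/-- The sign `ε(|bᵢ|, |bⱼ|)`, as a scalar. -/
def sgn (ε : G → G → Kˣ) (deg : B → G) (i j : B) : K := ε (deg i) (deg j)

theorem sgn_mul {deg : B → G} (hε : IsBicharacter ε) (i j : B) :
    sgn ε deg i j * sgn ε deg j i = 1 := by
  rw [sgn, sgn, ← Units.val_mul, hε.antisymm, Units.val_one]

namespace LieStr

variable (L : LieStr ε 𝒱) (ω : ↥L.Z2) (b : B → V) (deg : B → G)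

/-- The sum, over the letters of a word, of the terms of lower order that arise when that letter is
pulled to the front with the help of the defining relations of `U_ω(L)`. -/
def exchSum : List B → TensorAlgebra K V
  | [] => 0
  | a :: l => ι K (b a) * exchSum l
      + pullSum (sgn ε deg) l fun i r => L.corr ω (b a) (b i) * vecWord b r

/-- For a word of length `n`, the tensor of order less than `n` to which the difference between the
word and its `ε`-symmetrization reduces in `U_ω(L)`. It is obtained by averaging over the letter
that comes first and symmetrizing the rest. -/
def straighten : ℕ → List B → TensorAlgebra K V
  | 0, _ => 0
  | n + 1, l => (n + 1 : K)⁻¹ • (exchSum L ω b deg l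
      + pullSum (sgn ε deg) l fun i r => ι K (b i) * straighten n r)

variable {L ω b deg}

theorem relator_basis (i j : B) :
    L.relator ω (sgn ε deg i j) (b i) (b j)
      = ι K (b i) * ι K (b j) - sgn ε deg i j • (ι K (b j) * ι K (b i))
        - L.corr ω (b i) (b j) := rfl

variable [DecidableEq G] [DirectSum.Decomposition 𝒱]

theorem exchSum_mem (hb : ∀ i, b i ∈ 𝒱 (deg i)) {l : List B} {n : ℕ} (hl : l.length ≤ n + 1) :
    L.exchSum ω b deg l ∈ tensorLE 𝒱 n := by
  induction l generalizing n with
  | nil => exact Submodule.zero_mem _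
  | cons a l ih =>
    simp only [List.length_cons] at hl
    refine Submodule.add_mem _ ?_ (pullSum_mem _ fun i r hr => ?_)
    · cases n with
      | zero =>
        have : l = [] := List.length_eq_zero_iff.1 (by omega)
        subst this
        simp [exchSum]
      | succ n => exact tensorLE_mul (by omega) (ι_mem_tensorLE _) (ih (n := n) (by omega))
    · exact tensorLE_mul (p := 1) (q := r.length) (by omega) (corr_mem _ _)
        (vecWord_mem hb le_rfl)

/-- Modulo the relations of order at most that of the word, `exchSum` is the sum, over the letters,
of the differences between the word and the word with that letter pulled to the front, with
its sign. -/
theorem exchSum_sub_mem (hb : ∀ i, b i ∈ 𝒱 (deg i)) (l : List B) :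
    L.exchSum ω b deg l - (l.length : K) • vecWord b l
      + pullSum (sgn ε deg) l (fun i r => ι K (b i) * vecWord b r) ∈ L.relSpan ω l.length := by
  induction l with
  | nil => simp [exchSum, pullSum]
  | cons a l ih =>
    have h1 : ι K (b a) * (L.exchSum ω b deg l - (l.length : K) • vecWord b l
        + pullSum (sgn ε deg) l (fun i r => ι K (b i) * vecWord b r))
        ∈ L.relSpan ω (l.length + 1) :=
      mul_mem_relSpan (by omega) (ι_mem_tensorLE _) ih
    have h2 : pullSum (sgn ε deg) l (fun i r => L.relator ω (sgn ε deg a i) (b a) (b i)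
        * vecWord b r) ∈ L.relSpan ω (l.length + 1) :=
      pullSum_mem _ fun i r hr => relator_mul_mem (hb a) (hb i) (m := r.length) (by omega)
        (vecWord_mem hb le_rfl)
    have h3 : ι K (b a) * pullSum (sgn ε deg) l (fun i r => ι K (b i) * vecWord b r)
        = pullSum (sgn ε deg) l fun i r => ι K (b a) * (ι K (b i) * vecWord b r) :=
      map_pullSum (LinearMap.mulLeft K (ι K (b a))) _ _
    have h4 := Submodule.sub_mem _ h1 h2
    simp only [relator_basis, sub_mul, ← pullSum_sub, smul_mul_assoc, mul_assoc] at h4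
    refine (congrArg (· ∈ L.relSpan ω (l.length + 1)) ?_).mpr h4
    simp only [exchSum, pullSum, List.length_cons, vecWord_cons, mul_add, mul_sub, h3,
      mul_smul_comm]
    push_cast
    module

/-- The effect on `exchSum` of exchanging two neighbouring letters, modulo relations of order less
than that of the word. This is where the Jacobi and cocycle identities enter. -/
theorem exchSum_swap_mem (hε : IsBicharacter ε) (hb : ∀ i, b i ∈ 𝒱 (deg i)) (a c : B)
    (u v : List B) :
    L.exchSum ω b deg (u ++ a :: c :: v)
        - sgn ε deg a c • L.exchSum ω b deg (u ++ c :: a :: v)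
        - ((u.length : K) + v.length + 2) • (vecWord b u * L.corr ω (b a) (b c) * vecWord b v)
        + pullSum₂ (sgn ε deg) (fun i => sgn ε deg a i * sgn ε deg c i) u v (fun i u' v' =>
          ι K (b i) * (vecWord b u' * L.corr ω (b a) (b c) * vecWord b v'))
      ∈ L.relSpan ω (u.length + v.length + 1) := by
  induction u with
  | nil =>
    -- Pulling out `a` or `c` from `a ⬝ c ⬝ v` produces overlaps of `a`, `c` and a letter of `v`.
    have h1 : L.relator ω (sgn ε deg a c) (b a) (b c) * L.exchSum ω b deg v
        ∈ L.relSpan ω (v.length + 1) := by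
      cases v with
      | nil => simp [exchSum]
      | cons d v =>
        exact relator_mul_mem (hb a) (hb c) (m := v.length) (by simp) (exchSum_mem hb (by simp))
    have h2 : L.corr ω (b a) (b c) * (L.exchSum ω b deg v - (v.length : K) • vecWord b v
        + pullSum (sgn ε deg) v (fun i r => ι K (b i) * vecWord b r))
        ∈ L.relSpan ω (v.length + 1) :=
      mul_mem_relSpan (by omega) (corr_mem _ _) (exchSum_sub_mem hb v)
    have h3 : pullSum (sgn ε deg) v (fun i r =>
        (ι K (b a) * L.corr ω (b c) (b i) + sgn ε deg c i • (L.corr ω (b a) (b i) * ι K (b c))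
          - sgn ε deg a c • (ι K (b c) * L.corr ω (b a) (b i))
          - (sgn ε deg a c * sgn ε deg a i) • (L.corr ω (b c) (b i) * ι K (b a))
          - L.corr ω (b a) (b c) * ι K (b i)
          + (sgn ε deg a i * sgn ε deg c i) • (ι K (b i) * L.corr ω (b a) (b c))) * vecWord b r)
        ∈ L.relSpan ω (v.length + 1) := by
      refine pullSum_mem _ fun i r hr => relSpan_mul_mem (m := 2) (k := r.length) (by omega) ?_
        (vecWord_mem hb le_rfl)
      have := overlap_eq (L := L) (ω := ω) hε (hb a) (hb c) (hb i)
      simp only [sgn]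
      rw [this]
      exact Submodule.sub_mem _ (Submodule.sub_mem _
        (relator_mem_relSpan (hb a) (L.graded (hb c) (hb i)))
        (Submodule.smul_mem _ _ (relator_mem_relSpan (hb c) (L.graded (hb a) (hb i)))))
        (relator_mem_relSpan (L.graded (hb a) (hb c)) (hb i))
    have h4 := Submodule.add_mem _ (Submodule.add_mem _ h1 h2) h3
    have hsk : sgn ε deg a c • L.corr ω (b c) (b a) = - L.corr ω (b a) (b c) := by
      rw [corr_skew (L := L) (ω := ω) (hb a) (hb c), neg_neg, sgn]
    have hm : ∀ (t : TensorAlgebra K V) (f : B → List B → TensorAlgebra K V),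
        t * pullSum (sgn ε deg) v f = pullSum (sgn ε deg) v fun i r => t * f i r :=
      fun t f => map_pullSum (LinearMap.mulLeft K t) _ _
    have hP : ι K (b a) * pullSum (sgn ε deg) v (fun i r => L.corr ω (b c) (b i) * vecWord b r)
        + pullSum (sgn ε deg) v
          (fun i r => sgn ε deg c i • (L.corr ω (b a) (b i) * vecWord b (c :: r)))
        - sgn ε deg a c • (ι K (b c)
          * pullSum (sgn ε deg) v (fun i r => L.corr ω (b a) (b i) * vecWord b r))
        - sgn ε deg a c • pullSum (sgn ε deg) v
          (fun i r => sgn ε deg a i • (L.corr ω (b c) (b i) * vecWord b (a :: r)))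
        + pullSum (sgn ε deg) v (fun i r => (sgn ε deg a i * sgn ε deg c i) •
          (ι K (b i) * (vecWord b [] * L.corr ω (b a) (b c) * vecWord b r)))
        - L.corr ω (b a) (b c) * pullSum (sgn ε deg) v (fun i r => ι K (b i) * vecWord b r)
        = pullSum (sgn ε deg) v fun i r =>
          (ι K (b a) * L.corr ω (b c) (b i) + sgn ε deg c i • (L.corr ω (b a) (b i) * ι K (b c))
          - sgn ε deg a c • (ι K (b c) * L.corr ω (b a) (b i))
          - (sgn ε deg a c * sgn ε deg a i) • (L.corr ω (b c) (b i) * ι K (b a))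
          - L.corr ω (b a) (b c) * ι K (b i)
          + (sgn ε deg a i * sgn ε deg c i) • (ι K (b i) * L.corr ω (b a) (b c)))
          * vecWord b r := by
      simp only [hm, pullSum_smul, pullSum_add, pullSum_sub]
      congr 1
      funext i r
      simp only [vecWord_cons, vecWord_nil, one_mul, add_mul, sub_mul, smul_mul_assoc, mul_assoc,
        smul_smul]
      abel
    have hl : ([] : List B).length + v.length + 1 = v.length + 1 := by simp
    rw [hl]
    refine (congrArg (· ∈ L.relSpan ω _) ?_).mpr h4
    have hsk' : sgn ε deg a c • (L.corr ω (b c) (b a) * vecWord b v)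
        = -(L.corr ω (b a) (b c) * vecWord b v) := by
      rw [← smul_mul_assoc, hsk, neg_mul]
    simp only [List.nil_append, relator_basis, exchSum, pullSum, pullSum₂, List.length_nil,
      vecWord_nil, vecWord_cons, mul_add, mul_sub, sub_mul, smul_add, mul_smul_comm,
      smul_mul_assoc, mul_assoc, one_mul] at hP ⊢
    push_cast
    linear_combination (norm := module) hP - hsk'
  | cons d u ih =>
    -- The letter `d` in front of `u` is exchanged with a letter of `u` or `v`, next to an exchange
    -- of `a` and `c`: the two relations do not overlap.
    have h1 := mul_mem_relSpan (n := u.length + v.length + 2) (by omega)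
      (ι_mem_tensorLE (𝒱 := 𝒱) (b d)) ih
    have hlen : ∀ u' v' : List B, vecWord b u' * L.corr ω (b a) (b c) * vecWord b v'
        ∈ tensorLE 𝒱 (u'.length + v'.length + 1) := fun u' v' =>
      tensorLE_mul (p := u'.length + 1) (q := v'.length) (by omega)
        (tensorLE_mul le_rfl (vecWord_mem hb le_rfl) (corr_mem _ _)) (vecWord_mem hb le_rfl)
    have h2 : pullSum₂ (sgn ε deg) (fun i => sgn ε deg a i * sgn ε deg c i) u v
        (fun i u' v' => L.relator ω (sgn ε deg d i) (b d) (b i)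
          * (vecWord b u' * L.corr ω (b a) (b c) * vecWord b v'))
        ∈ L.relSpan ω (u.length + v.length + 2) :=
      pullSum₂_mem _ fun i u' v' hl => relator_mul_mem (hb d) (hb i) (by omega) (hlen u' v')
    have h3 : pullSum₂ (sgn ε deg) (fun i => sgn ε deg a i * sgn ε deg c i) u v
        (fun i u' v' => L.corr ω (b d) (b i)
          * (vecWord b u' * (L.relator ω (sgn ε deg a c) (b a) (b c) * vecWord b v')))
        ∈ L.relSpan ω (u.length + v.length + 2) :=
      pullSum₂_mem _ fun i u' v' hl => mul_mem_relSpan (k := 1) (m := u'.length + v'.length + 2)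
        (by omega) (corr_mem _ _) (mul_mem_relSpan (k := u'.length) (m := v'.length + 2) (by omega)
          (vecWord_mem hb le_rfl) (relator_mul_mem (hb a) (hb c) le_rfl (vecWord_mem hb le_rfl)))
    have h4 := Submodule.sub_mem _ (Submodule.add_mem _ h1 h3) h2
    have hs := pullSum_swap (e := sgn ε deg) (sgn_mul hε a c) u v
      fun i r => L.corr ω (b d) (b i) * vecWord b r
    have hm : ∀ (t : TensorAlgebra K V) (f : B → List B → List B → TensorAlgebra K V),
        t * pullSum₂ (sgn ε deg) (fun i => sgn ε deg a i * sgn ε deg c i) u v f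
          = pullSum₂ (sgn ε deg) (fun i => sgn ε deg a i * sgn ε deg c i) u v
            fun i u' v' => t * f i u' v' :=
      fun t f => map_pullSum₂ (LinearMap.mulLeft K t) _ _ _
    have hP : pullSum₂ (sgn ε deg) (fun i => sgn ε deg a i * sgn ε deg c i) u v
          (fun i u' v' => L.corr ω (b d) (b i) * vecWord b (u' ++ a :: c :: v')
            - sgn ε deg a c • (L.corr ω (b d) (b i) * vecWord b (u' ++ c :: a :: v')))
        - ι K (b d) * pullSum₂ (sgn ε deg) (fun i => sgn ε deg a i * sgn ε deg c i) u v
          (fun i u' v' => ι K (b i) * (vecWord b u' * L.corr ω (b a) (b c) * vecWord b v'))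
        + pullSum₂ (sgn ε deg) (fun i => sgn ε deg a i * sgn ε deg c i) u v
          (fun i u' v' => sgn ε deg d i • (ι K (b i)
            * (vecWord b (d :: u') * L.corr ω (b a) (b c) * vecWord b v')))
        = pullSum₂ (sgn ε deg) (fun i => sgn ε deg a i * sgn ε deg c i) u v
            (fun i u' v' => L.corr ω (b d) (b i)
              * (vecWord b u' * (L.relator ω (sgn ε deg a c) (b a) (b c) * vecWord b v')))
          - pullSum₂ (sgn ε deg) (fun i => sgn ε deg a i * sgn ε deg c i) u v
            (fun i u' v' => L.relator ω (sgn ε deg d i) (b d) (b i)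
              * (vecWord b u' * L.corr ω (b a) (b c) * vecWord b v')) := by
      simp only [hm, pullSum₂_add, pullSum₂_sub]
      congr 1
      funext i u' v'
      simp only [relator_basis, vecWord_cons, vecWord_append, sub_mul, mul_sub, smul_mul_assoc,
        mul_smul_comm, mul_assoc]
      module
    rw [← hs] at hP
    have hl : (d :: u).length + v.length + 1 = u.length + v.length + 2 := by
      simp only [List.length_cons]
      omega
    rw [hl]
    refine (congrArg (· ∈ L.relSpan ω _) ?_).mpr h4
    simp only [List.cons_append, exchSum, pullSum₂, List.length_cons,
      vecWord_cons, mul_add, mul_sub, smul_add, mul_smul_comm, mul_assoc] at hP ⊢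
    push_cast
    linear_combination (norm := module) hP

/-- Exchanging two neighbouring letters of a word changes `straighten` by the right-hand side of the
defining relation, modulo relations of order less than that of the word. -/
theorem straighten_swap_mem [CharZero K] (hε : IsBicharacter ε) (hb : ∀ i, b i ∈ 𝒱 (deg i))
    (a c : B) {n : ℕ} {u v : List B} (hn : n = u.length + v.length + 2) :
    L.straighten ω b deg n (u ++ a :: c :: v)
        - sgn ε deg a c • L.straighten ω b deg n (u ++ c :: a :: v)
        - vecWord b u * L.corr ω (b a) (b c) * vecWord b v
      ∈ L.relSpan ω (n - 1) := by
  induction n generalizing u v with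
  | zero => omega
  | succ n ih =>
    obtain rfl : n = u.length + v.length + 1 := by omega
    set n := u.length + v.length + 1 with hn'
    have h1 := exchSum_swap_mem (L := L) (ω := ω) hε hb a c u v
    have hs := pullSum_swap (e := sgn ε deg) (sgn_mul hε a c) u v
      fun i r => ι K (b i) * L.straighten ω b deg n r
    have h2 : pullSum₂ (sgn ε deg) (fun i => sgn ε deg a i * sgn ε deg c i) u v
        (fun i u' v' => ι K (b i) * (L.straighten ω b deg n (u' ++ a :: c :: v')
        - sgn ε deg a c • L.straighten ω b deg n (u' ++ c :: a :: v')
        - vecWord b u' * L.corr ω (b a) (b c) * vecWord b v')) ∈ L.relSpan ω n :=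
      pullSum₂_mem _ fun i u' v' hl => mul_mem_relSpan (k := 1) (m := n - 1) (by omega)
        (ι_mem_tensorLE _) (ih (by omega))
    simp only [mul_sub, ← pullSum₂_sub, mul_smul_comm] at h2
    simp only [pullSum₂_sub] at h2
    rw [← pullSum₂_sub, ← hs] at h2
    have h3 := Submodule.smul_mem _ ((n + 1 : K)⁻¹) (Submodule.add_mem _ h1 h2)
    refine (congrArg (· ∈ L.relSpan ω _) ?_).mpr h3
    have hne : ((u.length : K) + v.length + 2) ≠ 0 := by
      exact_mod_cast (by omega : u.length + v.length + 2 ≠ 0)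
    have hc : (n + 1 : K) = (u.length : K) + v.length + 2 := by
      rw [hn']
      push_cast
      ring
    simp only [straighten, hc]
    match_scalars <;> field_simp
    ring1

end LieStr
end Straightening

/-! ### Homogeneous bases and the words in them -/

section HomogeneousBasis

open TensorAlgebra (ι)

/-- A graded space has a basis of homogeneous vectors; it spans every component by the basis vectors
of that degree. -/
theorem exists_homogeneous_basis {K : Type u} [Field K] {G : Type w} [DecidableEq G] {V : Type v}
    [AddCommGroup V] [Module K V] (𝒱 : G → Submodule K V) [DirectSum.Decomposition 𝒱] :
    ∃ (B : Type (max v w)) (b : Module.Basis B K V) (deg : B → G), (∀ i, b i ∈ 𝒱 (deg i)) ∧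
      ∀ g, 𝒱 g ≤ Submodule.span K {x | ∃ i, deg i = g ∧ b i = x} := by
  have hint := DirectSum.Decomposition.isInternal 𝒱
  refine ⟨_, hint.collectedBasis fun g => Module.Basis.ofVectorSpace K (𝒱 g), Sigma.fst,
    fun i => hint.collectedBasis_mem _ i, fun g x hx => ?_⟩
  have h := Submodule.mem_map_of_mem (f := (𝒱 g).subtype)
    ((Module.Basis.ofVectorSpace K (𝒱 g)).mem_span ⟨x, hx⟩)
  rw [Submodule.map_span] at h
  refine Submodule.span_mono ?_ h
  rintro _ ⟨_, ⟨i, rfl⟩, rfl⟩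
  exact ⟨⟨g, i⟩, rfl, by simp⟩

variable {K : Type u} [Field K] {G : Type w} [AddCommGroup G] {ε : G → G → Kˣ}
  {V : Type v} [AddCommGroup V] [Module K V] {𝒱 : G → Submodule K V}

variable {B : Type*} (b : Module.Basis B K V)

/-- The words in a basis of `V` form a basis of `T(V)`. -/
theorem tensorAlgebra_basis_apply (l : List B) :
    b.tensorAlgebra (FreeMonoid.ofList l) = vecWord b l := by
  have h : FreeAlgebra.basisFreeMonoid K B (FreeMonoid.ofList l)
      = FreeMonoid.lift (FreeAlgebra.ι K) (FreeMonoid.ofList l) := by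
    refine Eq.trans (MonoidAlgebra.lift_single (FreeMonoid.lift (FreeAlgebra.ι K))
      (FreeMonoid.ofList l) (1 : K)) (one_smul _ _)
  rw [Module.Basis.tensorAlgebra, Module.Basis.map_apply, h, FreeMonoid.lift_apply]
  simp [vecWord, map_list_prod, List.map_map, Function.comp_def]

theorem map_ι_prod_mem (l : List V) : (l.map (ι K)).prod
    ∈ Submodule.span K {t | ∃ l' : List B, l'.length = l.length ∧ vecWord b l' = t} := by
  induction l with
  | nil => exact Submodule.subset_span ⟨[], rfl, by simp⟩
  | cons x l ih =>
    rw [List.map_cons, List.prod_cons]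
    have h := Submodule.mul_mem_mul (Submodule.mem_map_of_mem (f := ι K) (b.mem_span x)) ih
    rw [Submodule.map_span, Submodule.span_mul_span] at h
    refine Submodule.span_mono ?_ h
    rintro _ ⟨_, ⟨_, ⟨i, rfl⟩, rfl⟩, _, ⟨l', hl, rfl⟩, rfl⟩
    exact ⟨i :: l', by simp [hl], by simp⟩

theorem tensorLE_le_span (n : ℕ) : tensorLE 𝒱 n
    ≤ Submodule.span K {t | ∃ l : List B, l.length ≤ n ∧ vecWord b l = t} := by
  refine Submodule.span_le.2 ?_
  rintro _ ⟨l, hl, rfl⟩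
  have h := map_ι_prod_mem b (l.map fun p => (p.2 : V))
  rw [List.map_map] at h
  refine Submodule.span_mono ?_ h
  rintro _ ⟨l', hl', rfl⟩
  exact ⟨l', by simpa [hl'] using hl, rfl⟩

theorem tensorAlgebra_linear_ext {M : Type*} [AddCommMonoid M] [Module K M]
    {f f' : TensorAlgebra K V →ₗ[K] M} (h : ∀ l, f (vecWord b l) = f' (vecWord b l)) : f = f' :=
  b.tensorAlgebra.ext fun l => by
    have := h l.toList
    rwa [← tensorAlgebra_basis_apply] at this

/-- The linear map on `T(V)` with prescribed values on the words in a basis. -/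
def wordConstr {M : Type*} [AddCommGroup M] [Module K M] (f : List B → M) :
    TensorAlgebra K V →ₗ[K] M :=
  b.tensorAlgebra.constr K fun l => f l.toList

@[simp] theorem wordConstr_apply {M : Type*} [AddCommGroup M] [Module K M] (f : List B → M)
    (l : List B) : wordConstr b f (vecWord b l) = f l := by
  rw [← tensorAlgebra_basis_apply, wordConstr, Module.Basis.constr_basis]
  rfl

open Classical in
/-- The component of order `n` of a tensor. -/
def tensorPart (n : ℕ) : TensorAlgebra K V →ₗ[K] TensorAlgebra K V :=
  wordConstr b fun l => if l.length = n then vecWord b l else 0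

theorem tensorPart_vecWord (n : ℕ) (l : List B) :
    tensorPart b n (vecWord b l) = if l.length = n then vecWord b l else 0 := by
  simp [tensorPart]

theorem tensorPart_prod (n : ℕ) (l : List V) : tensorPart b n (l.map (ι K)).prod
    = if l.length = n then (l.map (ι K)).prod else 0 := by
  have h := map_ι_prod_mem b l
  generalize (l.map (ι K)).prod = t at h ⊢
  induction h using Submodule.span_induction with
  | mem t h =>
    obtain ⟨l', hl, rfl⟩ := h
    rw [tensorPart_vecWord, hl]
  | zero => simp
  | add s t _ _ hs ht => rw [map_add, hs, ht]; split_ifs <;> simp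
  | smul c t _ ht => rw [map_smul, ht]; split_ifs <;> simp

theorem exists_mem_tensorLE [DecidableEq G] [DirectSum.Decomposition 𝒱]
    (t : TensorAlgebra K V) : ∃ n, t ∈ tensorLE 𝒱 n := by
  induction t using TensorAlgebra.induction with
  | algebraMap c => exact ⟨0, algebraMap_mem_tensorLE _ _⟩
  | ι x => exact ⟨1, ι_mem_tensorLE _⟩
  | mul s t hs ht =>
    obtain ⟨m, hm⟩ := hs
    obtain ⟨n, hn⟩ := ht
    exact ⟨m + n, tensorLE_mul le_rfl hm hn⟩
  | add s t hs ht =>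
    obtain ⟨m, hm⟩ := hs
    obtain ⟨n, hn⟩ := ht
    exact ⟨m + n, Submodule.add_mem _ (tensorLE_mono (by omega) hm)
      (tensorLE_mono (by omega) hn)⟩

omit [AddCommGroup G] in
theorem tensorPart_homogeneous_prod (n : ℕ)
    (l : List (Σ g, ↥(𝒱 g))) : tensorPart b n (l.map fun p => ι K (p.2 : V)).prod
      = if l.length = n then (l.map fun p => ι K (p.2 : V)).prod else 0 := by
  simpa [List.map_map, Function.comp_def] using tensorPart_prod b n (l.map fun p => (p.2 : V))

theorem tensorPart_mem [DecidableEq G] [DirectSum.Decomposition 𝒱] (n : ℕ) (t : TensorAlgebra K V) :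
    tensorPart b n t ∈ tensorLE 𝒱 n := by
  obtain ⟨N, hN⟩ := exists_mem_tensorLE (𝒱 := 𝒱) t
  have h : tensorLE 𝒱 N ≤ (tensorLE 𝒱 n).comap (tensorPart b n) := by
    refine Submodule.span_le.2 ?_
    rintro _ ⟨l, hl, rfl⟩
    rw [SetLike.mem_coe, Submodule.mem_comap, tensorPart_homogeneous_prod]
    split_ifs with h
    · exact Submodule.subset_span ⟨l, h.le, rfl⟩
    · exact Submodule.zero_mem _
  exact h hN

theorem sum_tensorPart {N : ℕ} {t : TensorAlgebra K V} (ht : t ∈ tensorLE 𝒱 N) :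
    ∑ n ∈ Finset.range (N + 1), tensorPart b n t = t := by
  replace ht := tensorLE_le_span b N ht
  induction ht using Submodule.span_induction with
  | mem t h =>
    obtain ⟨l, hl, rfl⟩ := h
    simp only [tensorPart_vecWord, Finset.sum_ite_eq, Finset.mem_range]
    rw [if_pos (by omega)]
  | zero => simp
  | add s t _ _ hs ht => simp only [map_add, Finset.sum_add_distrib, hs, ht]
  | smul c t _ ht => simp only [map_smul, ← Finset.smul_sum, ht]

end HomogeneousBasis

/-! ### The defining ideal and the order of tensors -/

/-- The kernel congruence of the projection to the quotient by `r` is generated by `r`. -/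
theorem ringConGen_of_mkAlgHom_eq {R A : Type*} [CommRing R] [Ring A] [Algebra R A]
    {r : A → A → Prop} {a a' : A} (h : RingQuot.mkAlgHom R r a = RingQuot.mkAlgHom R r a') :
    RingConGen.Rel r a a' := by
  have h' : RingQuot.mkRingHom r a = RingQuot.mkRingHom r a' := by
    rw [← RingQuot.mkAlgHom_coe R]
    exact h
  rw [← RingQuot.eqvGen_rel_eq]
  simp only [RingQuot.mkRingHom_def] at h'
  exact Quot.eq.1 (RingQuot.mk.inj h')

namespace LieStr

open TensorAlgebra (ι)

variable {K : Type u} [Field K] {G : Type w} [AddCommGroup G] {ε : G → G → Kˣ}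
  {V : Type v} [AddCommGroup V] [Module K V] {𝒱 : G → Submodule K V}
  {L : LieStr ε 𝒱} {ω : ↥L.Z2}

variable (L ω) in
/-- `relator` as a bilinear map. -/
def relatorₗ (c : K) : V →ₗ[K] V →ₗ[K] TensorAlgebra K V :=
  LinearMap.mk₂ K (L.relator ω c)
    (fun x x' y => by simp only [relator, map_add, add_mul, mul_add, LinearMap.add_apply]; module)
    (fun r x y => by
      simp only [relator, map_smul, smul_mul_assoc, mul_smul_comm, LinearMap.smul_apply]; module)
    (fun x y y' => by simp only [relator, map_add, add_mul, mul_add]; module)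
    (fun r x y => by simp only [relator, map_smul, smul_mul_assoc, mul_smul_comm]; module)

/-- `relSpan` is spanned by the relations between basis vectors, multiplied by words in the
basis. -/
theorem relSpan_le_span {B : Type*} {b : Module.Basis B K V} {deg : B → G}
    (hs : ∀ g, 𝒱 g ≤ Submodule.span K {x | ∃ i, deg i = g ∧ b i = x}) (m : ℕ) :
    L.relSpan ω m ≤ Submodule.span K {t | ∃ (i j : B) (p q : List B),
      p.length + q.length + 2 ≤ m ∧
        vecWord b p * L.relator ω (sgn ε deg i j) (b i) (b j) * vecWord b q = t} := by
  set N := Submodule.span K {t | ∃ (i j : B) (p q : List B), p.length + q.length + 2 ≤ m ∧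
        vecWord b p * L.relator ω (sgn ε deg i j) (b i) (b j) * vecWord b q = t}
  refine Submodule.span_le.2 ?_
  rintro _ ⟨g, h, x, y, a, c, p, q, hx, hy, ha, hc, hpq, rfl⟩
  have ha' := tensorLE_le_span b p ha
  have hc' := tensorLE_le_span b q hc
  clear ha hc
  change LinearMap.mulRight K c (LinearMap.mulRight K (L.relator ω (ε g h) x y) a) ∈ N
  rw [← LinearMap.comp_apply, ← Submodule.mem_comap]
  refine Submodule.span_le.2 ?_ ha'
  rintro _ ⟨p', hp, rfl⟩
  change LinearMap.mulLeft K (vecWord b p' * L.relator ω (ε g h) x y) c ∈ N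
  rw [← Submodule.mem_comap]
  refine Submodule.span_le.2 ?_ hc'
  rintro _ ⟨q', hq, rfl⟩
  change (LinearMap.mulRight K (vecWord b q') ∘ₗ LinearMap.mulLeft K (vecWord b p')
    ∘ₗ (L.relatorₗ ω (ε g h)).flip y) x ∈ N
  rw [← Submodule.mem_comap]
  refine Submodule.span_le.2 ?_ (hs g hx)
  rintro _ ⟨i, rfl, rfl⟩
  change (LinearMap.mulRight K (vecWord b q') ∘ₗ LinearMap.mulLeft K (vecWord b p')
    ∘ₗ (L.relatorₗ ω (ε (deg i) h)) (b i)) y ∈ N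
  rw [← Submodule.mem_comap]
  refine Submodule.span_le.2 ?_ (hs h hy)
  rintro _ ⟨j, rfl, rfl⟩
  exact Submodule.subset_span ⟨i, j, p', q', by omega, rfl⟩

variable [DecidableEq G] [DirectSum.Decomposition 𝒱]

theorem relator_mem_tensorLE (c : K) (x y : V) : L.relator ω c x y ∈ tensorLE 𝒱 2 :=
  Submodule.sub_mem _ (Submodule.sub_mem _
    (tensorLE_mul (p := 1) (q := 1) le_rfl (ι_mem_tensorLE _) (ι_mem_tensorLE _))
    (Submodule.smul_mem _ _
      (tensorLE_mul (p := 1) (q := 1) le_rfl (ι_mem_tensorLE _) (ι_mem_tensorLE _))))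
    (tensorLE_mono (by omega) (corr_mem x y))

theorem relSpan_le_tensorLE (m : ℕ) : L.relSpan ω m ≤ tensorLE 𝒱 m := by
  refine Submodule.span_le.2 ?_
  rintro _ ⟨g, h, x, y, a, c, p, q, hx, hy, ha, hc, hpq, rfl⟩
  exact tensorLE_mul (p := p + 2) (q := q) (by omega)
    (tensorLE_mul le_rfl ha (relator_mem_tensorLE _ _ _)) hc

/-- A relation of order at most `n + 1` whose terms of order `n + 1` cancel is a combination of
relations of order at most `n`: the map that is `straighten` on words of length `n + 1` and the
identity on shorter words carries the former relations into the latter. -/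
theorem relSpan_succ_inf_tensorLE [CharZero K] (hε : IsBicharacter ε) (n : ℕ) :
    L.relSpan ω (n + 1) ⊓ tensorLE 𝒱 n ≤ L.relSpan ω n := by
  classical
  obtain ⟨B, b, deg, hb, hs⟩ := exists_homogeneous_basis 𝒱
  let q : TensorAlgebra K V →ₗ[K] TensorAlgebra K V := wordConstr b fun l =>
    if l.length = n + 1 then L.straighten ω b deg (n + 1) l else vecWord b l
  have hq : ∀ t ∈ tensorLE 𝒱 n, q t = t := by
    intro t ht
    replace ht := tensorLE_le_span b n ht
    induction ht using Submodule.span_induction with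
    | mem t h =>
      obtain ⟨l, hl, rfl⟩ := h
      rw [wordConstr_apply, if_neg (by omega)]
    | zero => simp
    | add s t _ _ hs ht => rw [map_add, hs, ht]
    | smul c t _ ht => rw [map_smul, ht]
  have hJ : L.relSpan ω (n + 1) ≤ (L.relSpan ω n).comap q := by
    refine (relSpan_le_span hs (n + 1)).trans (Submodule.span_le.2 ?_)
    rintro _ ⟨i, j, p, p', hp, rfl⟩
    rw [SetLike.mem_coe, Submodule.mem_comap]
    have hgen : ∀ k, p.length + p'.length + 2 ≤ k →
        vecWord b p * L.relator ω (sgn ε deg i j) (b i) (b j) * vecWord b p' ∈ L.relSpan ω k :=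
      fun k hk => Submodule.subset_span ⟨_, _, _, _, _, _, p.length, p'.length, hb i, hb j,
        vecWord_mem hb le_rfl, vecWord_mem hb le_rfl, hk, rfl⟩
    rcases Nat.lt_or_ge (p.length + p'.length + 2) (n + 1) with h | h
    · have := hgen n (by omega)
      rwa [hq _ (relSpan_le_tensorLE n this)]
    · have hn : n + 1 = p.length + p'.length + 2 := by omega
      have key := straighten_swap_mem (L := L) (ω := ω) hε hb i j hn
      have hlow : q (vecWord b p * L.corr ω (b i) (b j) * vecWord b p')
          = vecWord b p * L.corr ω (b i) (b j) * vecWord b p' :=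
        hq _ (tensorLE_mul (p := p.length + 1) (q := p'.length) (by omega)
          (tensorLE_mul le_rfl (vecWord_mem hb le_rfl) (corr_mem _ _)) (vecWord_mem hb le_rfl))
      have e : vecWord b p * L.relator ω (sgn ε deg i j) (b i) (b j) * vecWord b p'
          = vecWord b (p ++ i :: j :: p') - sgn ε deg i j • vecWord b (p ++ j :: i :: p')
            - vecWord b p * L.corr ω (b i) (b j) * vecWord b p' := by
        simp only [relator_basis, mul_sub, sub_mul, vecWord_append, vecWord_cons, mul_assoc,
          mul_smul_comm, smul_mul_assoc]
      rw [e, map_sub, map_sub, map_smul, hlow, wordConstr_apply, wordConstr_apply,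
        if_pos (by simp; omega), if_pos (by simp; omega)]
      exact key
  rintro t ⟨h1, h2⟩
  have := hJ h1
  rwa [Submodule.mem_comap, hq t h2] at this

/-- A relation whose value is a tensor of order at most `n` is a combination of relations of order
at most `n`. -/
theorem mem_relSpan_of_mem_tensorLE [CharZero K] (hε : IsBicharacter ε) {m n : ℕ}
    {t : TensorAlgebra K V} (h : t ∈ L.relSpan ω m) (ht : t ∈ tensorLE 𝒱 n) :
    t ∈ L.relSpan ω n := by
  induction m with
  | zero => exact relSpan_mono (Nat.zero_le n) h
  | succ m ih =>
    rcases Nat.lt_or_ge m n with hmn | hmn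
    · exact relSpan_mono hmn h
    · exact ih (relSpan_succ_inf_tensorLE hε m ⟨h, tensorLE_mono hmn ht⟩)

/-- The kernel of `T(V) → U_ω(L)` is the union of the spaces `relSpan`. -/
theorem exists_mem_relSpan {s t : TensorAlgebra K V}
    (h : RingQuot.mkAlgHom K (L.EnvRel ω) s = RingQuot.mkAlgHom K (L.EnvRel ω) t) :
    ∃ m, s - t ∈ L.relSpan ω m := by
  have h' := ringConGen_of_mkAlgHom_eq h
  clear h
  induction h' with
  | of s t h =>
    obtain ⟨hx, hy⟩ := h
    exact ⟨2, relator_mem_relSpan hx hy⟩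
  | refl s => exact ⟨0, by simp⟩
  | symm _ ih =>
    obtain ⟨m, h⟩ := ih
    exact ⟨m, by rw [← neg_sub]; exact Submodule.neg_mem _ h⟩
  | trans _ _ ih ih' =>
    obtain ⟨m, h⟩ := ih
    obtain ⟨n, h'⟩ := ih'
    exact ⟨m + n, by
      rw [← sub_add_sub_cancel]
      exact Submodule.add_mem _ (relSpan_mono (by omega) h) (relSpan_mono (by omega) h')⟩
  | add _ _ ih ih' =>
    obtain ⟨m, h⟩ := ih
    obtain ⟨n, h'⟩ := ih'
    exact ⟨m + n, by
      rw [add_sub_add_comm]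
      exact Submodule.add_mem _ (relSpan_mono (by omega) h) (relSpan_mono (by omega) h')⟩
  | @mul s s' t t' _ _ ih ih' =>
    obtain ⟨m, h⟩ := ih
    obtain ⟨n, h'⟩ := ih'
    obtain ⟨p, hp⟩ := exists_mem_tensorLE (𝒱 := 𝒱) s'
    obtain ⟨q, hq⟩ := exists_mem_tensorLE (𝒱 := 𝒱) t
    exact ⟨m + n + p + q, by
      rw [show s * t - s' * t' = (s - s') * t + s' * (t - t') by noncomm_ring]
      exact Submodule.add_mem _ (relSpan_mul_mem (by omega) h hq)
        (mul_mem_relSpan (k := p) (m := n) (by omega) hp h')⟩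

end LieStr

/-! ### The pair `(U_ω(L), φ_ω)` is an object -/

section WordSpan

variable {K : Type u} [Field K] {G : Type w} [AddCommGroup G]
  {V : Type v} [AddCommGroup V] [Module K V] {𝒱 : G → Submodule K V}
  {A : Type*} [Ring A] [Algebra K A] {C : Type*} [Ring C] [Algebra K C]

theorem map_wordSpan (f : A →ₐ[K] C) (i : V →ₗ[K] A) (P : ℕ → G → Prop) :
    (wordSpan 𝒱 i P).map f.toLinearMap = wordSpan 𝒱 (f.toLinearMap.comp i) P := by
  rw [wordSpan, Submodule.map_span, wordSpan]
  congr 1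
  ext c
  constructor
  · rintro ⟨_, ⟨l, hl, rfl⟩, rfl⟩
    exact ⟨l, hl, by simp [map_list_prod, Function.comp_def]⟩
  · rintro ⟨l, hl, rfl⟩
    exact ⟨_, ⟨l, hl, rfl⟩, by simp [map_list_prod, Function.comp_def]⟩

theorem wordSpan_mono {i : V →ₗ[K] A} {P Q : ℕ → G → Prop} (h : ∀ n g, P n g → Q n g) :
    wordSpan 𝒱 i P ≤ wordSpan 𝒱 i Q :=
  Submodule.span_mono fun _ ⟨l, hl, e⟩ => ⟨l, h _ _ hl, e⟩

end WordSpan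

namespace AlgFiltration

variable {K : Type u} [Field K] {A : Type t} [Ring A] [Algebra K A] {fil : AlgFiltration K A}

theorem symbol_congr {m n : ℕ} (hmn : m = n) {a : ↥(fil.F m)} {b : ↥(fil.F n)}
    (h : (a : A) = b) : fil.symbol m a = fil.symbol n b := by
  subst hmn
  rw [Subtype.ext h]

theorem symbol_eq_zero_iff {n : ℕ} {a : ↥(fil.F n)} :
    fil.symbol n a = 0 ↔ (a : A) ∈ fil.below n := by
  have h1 : fil.symbol n a = 0 ↔ fil.cls n a = 0 := by
    constructor
    · intro h
      exact DirectSum.of_injective (β := fil.Gr) n (h.trans (map_zero _).symm)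
    · intro h
      rw [symbol, LinearMap.comp_apply, h, map_zero]
  rw [h1]
  exact Submodule.Quotient.mk_eq_zero _

theorem symbol_eq_iff {n : ℕ} {a b : ↥(fil.F n)} :
    fil.symbol n a = fil.symbol n b ↔ (a : A) - b ∈ fil.below n := by
  rw [← sub_eq_zero, ← map_sub, symbol_eq_zero_iff]
  rfl

end AlgFiltration

section SymAlg

variable {K : Type u} [Field K] {G : Type w} [AddCommGroup G] (ε : G → G → Kˣ)
  {V : Type v} [AddCommGroup V] [Module K V] (𝒱 : G → Submodule K V)

/-- The projection `T(V) → S(V)`. -/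
abbrev symMk :
    TensorAlgebra K V →ₐ[K] SymAlg ε 𝒱 :=
  RingQuot.mkAlgHom K (SymRel ε 𝒱)

variable {ε 𝒱}

omit [AddCommGroup G] in
theorem sym_algHom_ext {A : Type*} [Ring A] [Algebra K A]
    {f f' : SymAlg ε 𝒱 →ₐ[K] A} (h : ∀ x, f (symι ε 𝒱 x) = f' (symι ε 𝒱 x)) : f = f' :=
  RingQuot.ringQuot_ext' K _ _ (TensorAlgebra.hom_ext (LinearMap.ext h))

theorem map_symMk_wordSpan (n : ℕ) (g : G) :
    (wordSpan 𝒱 (TensorAlgebra.ι K) fun m g' => m = n ∧ g' = g).map (symMk ε 𝒱).toLinearMap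
      = symPiece ε 𝒱 n g :=
  map_wordSpan _ _ _

end SymAlg

namespace LieStr

open TensorAlgebra (ι)

variable {K : Type u} [Field K] {G : Type w} [AddCommGroup G] {ε : G → G → Kˣ}
  {V : Type v} [AddCommGroup V] [Module K V] {𝒱 : G → Submodule K V}
  (L : LieStr ε 𝒱) (ω : ↥L.Z2)

/-- The projection `T(V) → U_ω(L)`. -/
abbrev envMk : TensorAlgebra K V →ₐ[K] L.Env ω := RingQuot.mkAlgHom K (L.EnvRel ω)

theorem map_tensorLE (n : ℕ) :
    (tensorLE 𝒱 n).map (L.envMk ω).toLinearMap = (L.envFiltration ω).F n :=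
  map_wordSpan _ _ _

theorem envMk_mem {n : ℕ} {t : TensorAlgebra K V} (ht : t ∈ tensorLE 𝒱 n) :
    L.envMk ω t ∈ (L.envFiltration ω).F n := by
  rw [← map_tensorLE]
  exact Submodule.mem_map_of_mem ht

/-- The algebra homomorphism out of `U_ω(L)` determined by a linear map `V → A` that satisfies the
defining relations. -/
def envLift {A : Type*} [Ring A] [Algebra K A] (f : V →ₗ[K] A)
    (hf : ∀ g h x y, x ∈ 𝒱 g → y ∈ 𝒱 h → f x * f y - (ε g h : K) • (f y * f x)
      = f (L.bracket x y) + algebraMap K A (ω.1 x y)) : L.Env ω →ₐ[K] A :=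
  RingQuot.liftAlgHom K ⟨TensorAlgebra.lift K f, by
    rintro _ _ ⟨hx, hy⟩
    simpa [Units.smul_def] using hf _ _ _ _ hx hy⟩

theorem envLift_envι {A : Type*} [Ring A] [Algebra K A] (f : V →ₗ[K] A) (hf) (x : V) :
    L.envLift ω f hf (L.envι ω x) = f x := by
  simp [envLift, envι]

/-! ### The grading -/

theorem envGrading_gradedMonoid : SetLike.GradedMonoid (L.envGrading ω) where
  one_mem := Submodule.subset_span ⟨[], by simp⟩
  mul_mem _ _ _ _ ha hb :=
    mul_mem_wordSpan (fun _ _ _ _ h h' => by rw [h, h']) ha hb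

theorem envFiltration_homogeneous (n : ℕ) : (L.envFiltration ω).F n
    ≤ ⨆ g, (L.envFiltration ω).F n ⊓ L.envGrading ω g := by
  refine Submodule.span_le.2 ?_
  rintro _ ⟨l, hl, rfl⟩
  exact Submodule.mem_iSup_of_mem (l.map Sigma.fst).sum
    ⟨Submodule.subset_span ⟨l, hl, rfl⟩, Submodule.subset_span ⟨l, rfl, rfl⟩⟩

theorem proj_of_mem [DecidableEq G] {g : G} {p : L.Env ω →ₗ[K] L.Env ω}
    (hp : ∀ l : List (Σ g, ↥(𝒱 g)),
      p (l.map fun q => L.envι ω (q.2 : V)).prod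
        = if (l.map Sigma.fst).sum = g then (l.map fun q => L.envι ω (q.2 : V)).prod else 0)
    {h : G} {a : L.Env ω} (ha : a ∈ L.envGrading ω h) : p a = if h = g then a else 0 := by
  induction ha using Submodule.span_induction with
  | mem a h =>
    obtain ⟨l, rfl, rfl⟩ := h
    exact hp l
  | zero => simp
  | add a a' _ _ ha ha' => rw [map_add, ha, ha']; split_ifs <;> simp
  | smul c a _ ha => rw [map_smul, ha]; split_ifs <;> simp

theorem below_eq_map (n : ℕ) : (L.envFiltration ω).below n
    = (wordSpan 𝒱 (ι K) fun m _ => m < n).map (L.envMk ω).toLinearMap := by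
  rw [map_wordSpan]
  cases n with
  | zero =>
    rw [AlgFiltration.below, wordSpan, eq_comm, Submodule.span_eq_bot]
    rintro _ ⟨l, hl, _⟩
    exact absurd hl (Nat.not_lt_zero _)
  | succ n => simp only [Nat.lt_succ_iff]; rfl

variable [DecidableEq G] [DirectSum.Decomposition 𝒱]

/-- The grading of `U_ω(L)` comes from a coaction of the group algebra of `G`. -/
theorem exists_coaction :
    ∃ δ : L.Env ω →ₐ[K] AddMonoidAlgebra (L.Env ω) G,
      ∀ g x, x ∈ 𝒱 g → δ (L.envι ω x) = AddMonoidAlgebra.single g (L.envι ω x) := by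
  obtain ⟨B, b, deg, hb, hs⟩ := exists_homogeneous_basis 𝒱
  let f : V →ₗ[K] AddMonoidAlgebra (L.Env ω) G :=
    b.constr K fun i => AddMonoidAlgebra.single (deg i) (L.envι ω (b i))
  have hf : ∀ g x, x ∈ 𝒱 g → f x = AddMonoidAlgebra.single g (L.envι ω x) := by
    intro g x hx
    replace hx := hs g hx
    induction hx using Submodule.span_induction with
    | mem x h =>
      obtain ⟨i, rfl, rfl⟩ := h
      simp [f]
    | zero => simp
    | add x y _ _ hx hy => rw [map_add, hx, hy, map_add, AddMonoidAlgebra.single_add]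
    | smul c x _ hx => rw [map_smul, hx, map_smul, AddMonoidAlgebra.smul_single]
  refine ⟨L.envLift ω f fun g h x y hx hy => ?_, fun g x hx => ?_⟩
  · rw [hf g x hx, hf h y hy, hf _ _ (L.graded hx hy), AddMonoidAlgebra.single_mul_single,
      AddMonoidAlgebra.single_mul_single, add_comm h g, AddMonoidAlgebra.smul_single,
      sub_eq_iff_eq_add]
    have e := L.envι_comm ω hx hy
    rw [sub_eq_iff_eq_add, Units.smul_def] at e
    rw [e, AddMonoidAlgebra.single_add, AddMonoidAlgebra.single_add]
    congr 2
    by_cases hgh : g + h = 0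
    · rw [hgh]
      rfl
    · rw [ω.2.1 g h x y hx hy hgh]
      simp
  · rw [envLift_envι, hf g x hx]

/-- The projection of `U_ω(L)` to its component of degree `g`. -/
theorem exists_proj (g : G) :
    ∃ p : L.Env ω →ₗ[K] L.Env ω, ∀ l : List (Σ g, ↥(𝒱 g)),
      p (l.map fun q => L.envι ω (q.2 : V)).prod
        = if (l.map Sigma.fst).sum = g then (l.map fun q => L.envι ω (q.2 : V)).prod else 0 := by
  obtain ⟨δ, hδ⟩ := L.exists_coaction ω
  have hl : ∀ l : List (Σ g, ↥(𝒱 g)), δ (l.map fun q => L.envι ω (q.2 : V)).prod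
      = AddMonoidAlgebra.single (l.map Sigma.fst).sum
        (l.map fun q => L.envι ω (q.2 : V)).prod := by
    intro l
    induction l with
    | nil => simp [AddMonoidAlgebra.one_def]
    | cons q l ih =>
      simp only [List.map_cons, List.prod_cons, List.sum_cons, map_mul, ih,
        hδ _ _ (SetLike.coe_mem q.2), AddMonoidAlgebra.single_mul_single]
  refine ⟨{ toFun := fun a => (δ a).coeff g
            map_add' := fun a a' => by simp
            map_smul' := fun c a => by simp }, fun l => ?_⟩
  change (δ _).coeff g = _
  rw [hl, AddMonoidAlgebra.coeff_single, Finsupp.single_apply]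

theorem envGrading_isInternal :
    DirectSum.IsInternal (L.envGrading ω) := by
  refine DirectSum.isInternal_submodule_of_iSupIndep_of_iSup_eq_top ?_ ?_
  · intro g
    obtain ⟨p, hp⟩ := L.exists_proj ω g
    rw [Submodule.disjoint_def]
    intro a ha ha'
    have h0 : (⨆ h, ⨆ (_ : h ≠ g), L.envGrading ω h) ≤ LinearMap.ker p :=
      iSup₂_le fun h hh a ha => by rw [LinearMap.mem_ker, L.proj_of_mem ω hp ha, if_neg hh]
    rw [← LinearMap.mem_ker.1 (h0 ha'), L.proj_of_mem ω hp ha, if_pos rfl]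
  · rw [eq_top_iff]
    intro a _
    obtain ⟨t, rfl⟩ := RingQuot.mkAlgHom_surjective K (L.EnvRel ω) a
    obtain ⟨n, hn⟩ := exists_mem_tensorLE (𝒱 := 𝒱) t
    have := L.envMk_mem ω hn
    refine Submodule.span_le.2 ?_ this
    rintro _ ⟨l, hl, rfl⟩
    exact Submodule.mem_iSup_of_mem _ (Submodule.subset_span ⟨l, rfl, rfl⟩)

/-- `Fₙ ∩ U_g` is spanned by the products of homogeneous vectors of length at most `n` and total
degree `g`. -/
theorem mem_wordSpan_of_mem_of_mem {n : ℕ} {g : G} {a : L.Env ω}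
    (ha : a ∈ (L.envFiltration ω).F n) (hg : a ∈ L.envGrading ω g) :
    a ∈ wordSpan 𝒱 (L.envι ω) fun m g' => m ≤ n ∧ g' = g := by
  obtain ⟨p, hp⟩ := L.exists_proj ω g
  have h : (L.envFiltration ω).F n
      ≤ (wordSpan 𝒱 (L.envι ω) fun m g' => m ≤ n ∧ g' = g).comap p := by
    refine Submodule.span_le.2 ?_
    rintro _ ⟨l, hl, rfl⟩
    rw [SetLike.mem_coe, Submodule.mem_comap, hp]
    split_ifs with h
    · exact Submodule.subset_span ⟨l, ⟨hl, h⟩, rfl⟩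
    · exact Submodule.zero_mem _
  have := h ha
  rwa [Submodule.mem_comap, L.proj_of_mem ω hp hg, if_pos rfl] at this

/-! ### The Poincaré–Birkhoff–Witt theorem -/

theorem envι_prod_mem (l : List V) :
    (l.map (L.envι ω)).prod ∈ (L.envFiltration ω).F l.length := by
  induction l with
  | nil => exact (L.envFiltration ω).one_mem
  | cons x l ih =>
    rw [List.map_cons, List.prod_cons, List.length_cons, add_comm]
    exact (L.envFiltration ω).mul_mem (L.envι_mem ω x) ih

theorem prod_envSymbol (l : List V) : (l.map (L.envSymbol ω)).prod
    = (L.envFiltration ω).symbol l.length ⟨_, L.envι_prod_mem ω l⟩ := by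
  induction l with
  | nil => rfl
  | cons x l ih =>
    rw [List.map_cons, List.prod_cons, ih]
    refine ((L.envFiltration ω).symbol_mul ⟨_, L.envι_mem ω x⟩ _).trans ?_
    exact AlgFiltration.symbol_congr (by simp [add_comm]) (by simp)

theorem envMk_vecWord_mem {B : Type*} (b : B → V) (l : List B) :
    L.envMk ω (vecWord b l) ∈ (L.envFiltration ω).F l.length := by
  have := L.envι_prod_mem ω (l.map b)
  simpa [vecWord, map_list_prod, envι, Function.comp_def] using this

theorem envφ_symMk_vecWord {B : Type*} (b : B → V) (l : List B) :
    L.envφ ω (symMk ε 𝒱 (vecWord b l))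
      = (L.envFiltration ω).symbol l.length ⟨_, L.envMk_vecWord_mem ω b l⟩ := by
  have h := L.prod_envSymbol ω (l.map b)
  have h1 : L.envφ ω (symMk ε 𝒱 (vecWord b l)) = ((l.map b).map (L.envSymbol ω)).prod := by
    rw [vecWord, map_list_prod, map_list_prod, List.map_map, List.map_map, List.map_map]
    congr 1
    exact List.map_congr_left fun i _ => L.envφ_symι ω (b i)
  rw [h1, h]
  exact AlgFiltration.symbol_congr (by simp)
    (by simp [vecWord, map_list_prod, envι, Function.comp_def])

theorem component_envφ {B : Type*} (b : Module.Basis B K V) (n : ℕ) (t : TensorAlgebra K V) :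
    DirectSum.component K ℕ (L.envFiltration ω).Gr n (L.envφ ω (symMk ε 𝒱 t))
      = (L.envFiltration ω).cls n
        ⟨L.envMk ω (tensorPart b n t), L.envMk_mem ω (tensorPart_mem b n t)⟩ := by
  let f : TensorAlgebra K V →ₗ[K] (L.envFiltration ω).Gr n :=
    DirectSum.component K ℕ (L.envFiltration ω).Gr n ∘ₗ (L.envφ ω).toLinearMap
      ∘ₗ (symMk ε 𝒱).toLinearMap
  let f' : TensorAlgebra K V →ₗ[K] (L.envFiltration ω).Gr n :=
    (L.envFiltration ω).cls n ∘ₗ LinearMap.codRestrict _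
      ((L.envMk ω).toLinearMap ∘ₗ tensorPart b n)
      (fun t => L.envMk_mem ω (tensorPart_mem b n t))
  suffices h : f = f' from congrArg (fun φ => φ t) h
  refine tensorAlgebra_linear_ext b fun l => ?_
  change DirectSum.component K ℕ (L.envFiltration ω).Gr n (L.envφ ω (symMk ε 𝒱 (vecWord b l)))
    = (L.envFiltration ω).cls n
        ⟨L.envMk ω (tensorPart b n (vecWord b l)), L.envMk_mem ω (tensorPart_mem b n _)⟩
  rw [envφ_symMk_vecWord]
  by_cases hn : l.length = n
  · subst hn
    refine (DirectSum.component.lof_self _ _ _).trans (congrArg _ (Subtype.ext ?_))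
    change L.envMk ω _ = L.envMk ω _
    rw [tensorPart_vecWord, if_pos rfl]
  · have h0 : (⟨L.envMk ω (tensorPart b n (vecWord b l)), L.envMk_mem ω (tensorPart_mem b n _)⟩ :
        ↥((L.envFiltration ω).F n)) = 0 := by
      refine Subtype.ext ?_
      change L.envMk ω _ = 0
      rw [tensorPart_vecWord, if_neg hn, map_zero]
    rw [h0, map_zero]
    exact (DirectSum.component.of _ _ _ _).trans (dif_neg hn)

/-- The injectivity of `φ_ω`, which is the essential part of the Poincaré–Birkhoff–Witt theorem. -/
theorem envφ_injective [CharZero K] (hε : IsBicharacter ε) :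
    Function.Injective (L.envφ ω) := by
  rw [injective_iff_map_eq_zero]
  intro s hs
  obtain ⟨t, rfl⟩ := RingQuot.mkAlgHom_surjective K (SymRel ε 𝒱) s
  obtain ⟨B, b, deg, hb, hsp⟩ := exists_homogeneous_basis 𝒱
  -- The component of order `n` of a relation of order at most `n` vanishes in `S(V)`.
  have htop : ∀ n, ∀ r ∈ L.relSpan ω n, symMk ε 𝒱 (tensorPart b n r) = 0 := by
    intro n
    suffices h : L.relSpan ω n
        ≤ LinearMap.ker ((symMk ε 𝒱).toLinearMap ∘ₗ tensorPart b n) from fun r hr => h hr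
    refine (relSpan_le_span hsp n).trans (Submodule.span_le.2 ?_)
    rintro _ ⟨i, j, p, q, hpq, rfl⟩
    change symMk ε 𝒱 (tensorPart b n _) = 0
    have hlow : tensorPart b n (vecWord b p * L.corr ω (b i) (b j) * vecWord b q) = 0 := by
      have hmem : vecWord b p * L.corr ω (b i) (b j) * vecWord b q
          ∈ tensorLE 𝒱 (p.length + q.length + 1) :=
        tensorLE_mul (p := p.length + 1) (q := q.length) (by omega)
          (tensorLE_mul le_rfl (vecWord_mem hb le_rfl) (corr_mem _ _)) (vecWord_mem hb le_rfl)
      have hle : tensorLE 𝒱 (p.length + q.length + 1) ≤ LinearMap.ker (tensorPart b n) := by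
        refine (tensorLE_le_span b _).trans (Submodule.span_le.2 ?_)
        rintro _ ⟨l, hl, rfl⟩
        change tensorPart b n _ = 0
        rw [tensorPart_vecWord, if_neg (by omega)]
      exact hle hmem
    have e : vecWord b p * L.relator ω (sgn ε deg i j) (b i) (b j) * vecWord b q
        = vecWord b (p ++ i :: j :: q) - sgn ε deg i j • vecWord b (p ++ j :: i :: q)
          - vecWord b p * L.corr ω (b i) (b j) * vecWord b q := by
      simp only [relator_basis, mul_sub, sub_mul, vecWord_append, vecWord_cons, mul_assoc,
        mul_smul_comm, smul_mul_assoc]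
    have hlen : (p ++ i :: j :: q).length = (p ++ j :: i :: q).length := by simp
    rw [e, map_sub, hlow, sub_zero, map_sub, map_smul, tensorPart_vecWord, tensorPart_vecWord,
      hlen]
    split_ifs
    · have hc := RingQuot.mkAlgHom_rel K (SymRel.comm (ε := ε) (𝒱 := 𝒱) (hb i) (hb j))
      simp only [vecWord_append, vecWord_cons, map_sub, map_smul, map_mul, Units.smul_def] at hc ⊢
      rw [← mul_assoc (symMk ε 𝒱 (ι K (b i))), hc, sgn]
      simp only [smul_mul_assoc, mul_smul_comm, mul_assoc, sub_self]
    · simp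
  -- If the symbol of the part of order `n` vanishes, this part differs from a tensor `r` of order
  -- less than `n` by a relation, which can be taken of order at most `n`.
  have hpart : ∀ n, symMk ε 𝒱 (tensorPart b n t) = 0 := by
    intro n
    have h := L.component_envφ ω b n t
    rw [show L.envφ ω (symMk ε 𝒱 t) = 0 from hs, map_zero, eq_comm] at h
    have h0 : L.envMk ω (tensorPart b n t) ∈ (L.envFiltration ω).below n :=
      AlgFiltration.symbol_eq_zero_iff.1
        ((congrArg (DirectSum.lof K ℕ (L.envFiltration ω).Gr n) h).trans (map_zero _))
    rw [below_eq_map] at h0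
    obtain ⟨r, hr, hrt⟩ := h0
    obtain ⟨m, hm⟩ := exists_mem_relSpan (L := L) (ω := ω) hrt
    have hr' : r ∈ tensorLE 𝒱 n := wordSpan_mono (fun _ _ h => h.le) hr
    have hr0 : tensorPart b n r = 0 := by
      have hle : (wordSpan 𝒱 (ι K) fun m _ => m < n) ≤ LinearMap.ker (tensorPart b n) := by
        refine Submodule.span_le.2 ?_
        rintro _ ⟨l, hl, rfl⟩
        change tensorPart b n _ = 0
        rw [tensorPart_homogeneous_prod, if_neg hl.ne]
      exact hle hr
    have hidem : tensorPart b n (tensorPart b n t) = tensorPart b n t := by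
      refine congrArg (fun f : TensorAlgebra K V →ₗ[K] TensorAlgebra K V => f t)
        (tensorAlgebra_linear_ext b (f := tensorPart b n ∘ₗ tensorPart b n) fun l => ?_)
      rw [LinearMap.comp_apply, tensorPart_vecWord]
      split_ifs with h
      · rw [tensorPart_vecWord, if_pos h]
      · rw [map_zero]
    have key := htop n _ (mem_relSpan_of_mem_tensorLE hε hm
      (Submodule.sub_mem _ hr' (tensorPart_mem b n t)))
    rwa [map_sub, hr0, hidem, zero_sub, map_neg, neg_eq_zero] at key
  obtain ⟨N, hN⟩ := exists_mem_tensorLE (𝒱 := 𝒱) t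
  change symMk ε 𝒱 t = 0
  rw [← sum_tensorPart b hN, map_sum]
  exact Finset.sum_eq_zero fun n _ => hpart n

theorem envφ_symMk_tensorPart {B : Type*} (b : Module.Basis B K V) (n : ℕ)
    (t : TensorAlgebra K V) : L.envφ ω (symMk ε 𝒱 (tensorPart b n t))
      = (L.envFiltration ω).symbol n
        ⟨L.envMk ω (tensorPart b n t), L.envMk_mem ω (tensorPart_mem b n t)⟩ := by
  let f : TensorAlgebra K V →ₗ[K] (L.envFiltration ω).gr :=
    (L.envφ ω).toLinearMap ∘ₗ (symMk ε 𝒱).toLinearMap ∘ₗ tensorPart b n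
  let f' : TensorAlgebra K V →ₗ[K] (L.envFiltration ω).gr :=
    (L.envFiltration ω).symbol n ∘ₗ LinearMap.codRestrict _
      ((L.envMk ω).toLinearMap ∘ₗ tensorPart b n)
      (fun t => L.envMk_mem ω (tensorPart_mem b n t))
  suffices h : f = f' from congrArg (fun φ => φ t) h
  refine tensorAlgebra_linear_ext (f := f) (f' := f') b fun l => ?_
  change L.envφ ω (symMk ε 𝒱 (tensorPart b n (vecWord b l))) = (L.envFiltration ω).symbol n
    ⟨L.envMk ω (tensorPart b n (vecWord b l)), L.envMk_mem ω (tensorPart_mem b n _)⟩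
  by_cases hn : l.length = n
  · subst hn
    have e : tensorPart b l.length (vecWord b l) = vecWord b l := by
      rw [tensorPart_vecWord, if_pos rfl]
    refine ((congrArg (fun t => L.envφ ω (symMk ε 𝒱 t)) e).trans
      (L.envφ_symMk_vecWord ω b l)).trans ?_
    exact AlgFiltration.symbol_congr rfl (congrArg (L.envMk ω) e.symm)
  · have e : tensorPart b n (vecWord b l) = 0 := by rw [tensorPart_vecWord, if_neg hn]
    refine (congrArg (fun t => L.envφ ω (symMk ε 𝒱 t)) e).trans ?_
    rw [map_zero, map_zero, eq_comm, AlgFiltration.symbol_eq_zero_iff]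
    change L.envMk ω (tensorPart b n (vecWord b l)) ∈ _
    rw [e, map_zero]
    exact Submodule.zero_mem _

/-- The symbol of an element of `U_ω(L)` is the image under `φ_ω` of the leading part of a
representing tensor. -/
theorem symbol_envMk {B : Type*} (b : Module.Basis B K V) {n : ℕ} {t : TensorAlgebra K V}
    (ht : t ∈ tensorLE 𝒱 n) :
    (L.envFiltration ω).symbol n ⟨L.envMk ω t, L.envMk_mem ω ht⟩
      = L.envφ ω (symMk ε 𝒱 (tensorPart b n t)) := by
  rw [envφ_symMk_tensorPart, AlgFiltration.symbol_eq_iff, below_eq_map, ← map_sub]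
  refine Submodule.mem_map_of_mem (f := (L.envMk ω).toLinearMap) ?_
  have h : tensorLE 𝒱 n ≤ (wordSpan 𝒱 (ι K) fun m _ => m < n).comap
      (LinearMap.id - tensorPart b n) := by
    refine Submodule.span_le.2 ?_
    rintro _ ⟨l, hl, rfl⟩
    rw [SetLike.mem_coe, Submodule.mem_comap, LinearMap.sub_apply, LinearMap.id_apply,
      tensorPart_homogeneous_prod]
    split_ifs with h
    · rw [sub_self]
      exact Submodule.zero_mem _
    · rw [sub_zero]
      exact Submodule.subset_span ⟨l, lt_of_le_of_ne hl h, rfl⟩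
  exact h ht

theorem envφ_surjective : Function.Surjective (L.envφ ω) := by
  obtain ⟨B, b, deg, hb, hsp⟩ := exists_homogeneous_basis 𝒱
  intro y
  change y ∈ (L.envφ ω).range
  induction y using DirectSum.induction_on with
  | zero => exact Subalgebra.zero_mem _
  | of n y =>
    induction y using Submodule.Quotient.induction_on with
    | _ a =>
    obtain ⟨a, ha⟩ := a
    have ha' := ha
    rw [← map_tensorLE] at ha'
    obtain ⟨t, ht, rfl⟩ := ha'
    exact ⟨_, (L.symbol_envMk ω b ht).symm⟩
  | add x y hx hy => exact Subalgebra.add_mem _ hx hy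

theorem envφ_mem_grPiece {n : ℕ} {g : G} {s : SymAlg ε 𝒱} (hs : s ∈ symPiece ε 𝒱 n g) :
    L.envφ ω s ∈ (L.envFiltration ω).grPiece (L.envGrading ω) n g := by
  obtain ⟨B, b, deg, hb, hsp⟩ := exists_homogeneous_basis 𝒱
  rw [← map_symMk_wordSpan] at hs
  obtain ⟨t, ht, rfl⟩ := hs
  have hle : t ∈ tensorLE 𝒱 n := wordSpan_mono (fun _ _ h => h.1.le) ht
  have hpart : tensorPart b n t = t := by
    have h : (wordSpan 𝒱 (ι K) fun m g' => m = n ∧ g' = g)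
        ≤ LinearMap.ker (tensorPart b n - LinearMap.id) := by
      refine Submodule.span_le.2 ?_
      rintro _ ⟨l, hl, rfl⟩
      rw [SetLike.mem_coe, LinearMap.mem_ker, LinearMap.sub_apply, LinearMap.id_apply,
        tensorPart_homogeneous_prod, if_pos hl.1, sub_self]
    exact sub_eq_zero.1 (h ht)
  refine ⟨⟨L.envMk ω t, L.envMk_mem ω hle⟩, ?_, ?_⟩
  · change L.envMk ω t ∈ L.envGrading ω g
    have := Submodule.mem_map_of_mem (f := (L.envMk ω).toLinearMap) ht
    rw [map_wordSpan] at this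
    exact wordSpan_mono (fun _ _ h => h.2) this
  · rw [symbol_envMk L ω b hle, hpart]
    rfl

theorem exists_symPiece {n : ℕ} {g : G} {y : (L.envFiltration ω).gr}
    (hy : y ∈ (L.envFiltration ω).grPiece (L.envGrading ω) n g) :
    ∃ s ∈ symPiece ε 𝒱 n g, L.envφ ω s = y := by
  obtain ⟨B, b, deg, hb, hsp⟩ := exists_homogeneous_basis 𝒱
  obtain ⟨⟨a, ha⟩, hg, rfl⟩ := hy
  have h := L.mem_wordSpan_of_mem_of_mem ω ha hg
  have e : L.envι ω = (L.envMk ω).toLinearMap.comp (ι K) := rfl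
  rw [e, ← map_wordSpan] at h
  obtain ⟨t, ht, rfl⟩ := h
  have hle : t ∈ tensorLE 𝒱 n := wordSpan_mono (fun _ _ h => h.1) ht
  refine ⟨symMk ε 𝒱 (tensorPart b n t), ?_, (L.symbol_envMk ω b hle).symm⟩
  rw [← map_symMk_wordSpan]
  refine Submodule.mem_map_of_mem (f := (symMk ε 𝒱).toLinearMap) ?_
  have h : (wordSpan 𝒱 (ι K) fun m g' => m ≤ n ∧ g' = g)
      ≤ (wordSpan 𝒱 (ι K) fun m g' => m = n ∧ g' = g).comap (tensorPart b n) := by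
    refine Submodule.span_le.2 ?_
    rintro _ ⟨l, hl, rfl⟩
    rw [SetLike.mem_coe, Submodule.mem_comap, tensorPart_homogeneous_prod]
    split_ifs with h
    · exact Submodule.subset_span ⟨l, ⟨h, hl.2⟩, rfl⟩
    · exact Submodule.zero_mem _
  exact h ht

/-- The bijectivity of `φ_ω` upgrades the inclusion of the graded pieces in one direction to an
equivalence. -/
theorem env_isObject [CharZero K] (hε : IsBicharacter ε) : (L.env ω).IsObject where
  gradedMonoid := L.envGrading_gradedMonoid ω
  isInternal := L.envGrading_isInternal ω
  exhaustive a := by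
    obtain ⟨t, rfl⟩ := RingQuot.mkAlgHom_surjective K (L.EnvRel ω) a
    obtain ⟨n, hn⟩ := exists_mem_tensorLE (𝒱 := 𝒱) t
    exact ⟨n, L.envMk_mem ω hn⟩
  homogeneous := L.envFiltration_homogeneous ω
  bijective := ⟨L.envφ_injective ω hε, L.envφ_surjective ω⟩
  graded n g s := by
    refine ⟨fun hs => L.envφ_mem_grPiece ω hs, fun hs => ?_⟩
    obtain ⟨s', hs', e⟩ := L.exists_symPiece ω hs
    rwa [← L.envφ_injective ω hε e]

end LieStr

/-! ### The low degrees of `S(V)` and of an object -/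

section LowDegree

variable {K : Type u} [Field K] {G : Type w} {ε : G → G → Kˣ}
  {V : Type v} [AddCommGroup V] [Module K V] {𝒱 : G → Submodule K V}

variable (ε 𝒱) in
/-- The quotient of `S(V)` by the elements of order at least `2` is the trivial square-zero
extension of `K` by `V`, so that `K` and `V` embed into `S(V)`. -/
def symToTrivSqZeroExt [Module Kᵐᵒᵖ V] [IsCentralScalar K V] :
    SymAlg ε 𝒱 →ₐ[K] TrivSqZeroExt K V :=
  RingQuot.liftAlgHom K ⟨TensorAlgebra.toTrivSqZeroExt, by
    rintro _ _ ⟨hx, hy⟩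
    simp [Units.smul_def]⟩

theorem symι_injective : Function.Injective (symι ε 𝒱) := by
  let _ : Module Kᵐᵒᵖ V := Module.compHom _ ((RingHom.id K).fromOpposite mul_comm)
  have _ : IsCentralScalar K V := ⟨fun r m => rfl⟩
  intro x y h
  have h' := congrArg (fun s => (symToTrivSqZeroExt ε 𝒱 s).snd) h
  simpa [symToTrivSqZeroExt, symι] using h'

theorem algebraMap_symAlg_injective : Function.Injective (algebraMap K (SymAlg ε 𝒱)) := by
  let _ : Module Kᵐᵒᵖ V := Module.compHom _ ((RingHom.id K).fromOpposite mul_comm)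
  have _ : IsCentralScalar K V := ⟨fun r m => rfl⟩
  intro x y h
  have h' := congrArg (fun s => (symToTrivSqZeroExt ε 𝒱 s).fst) h
  simpa [TrivSqZeroExt.algebraMap_eq_inl] using h'

variable [AddCommGroup G]

theorem exists_algebraMap_of_mem_symPiece {g : G} {s : SymAlg ε 𝒱} (hs : s ∈ symPiece ε 𝒱 0 g) :
    ∃ c : K, (g ≠ 0 → c = 0) ∧ s = algebraMap K _ c := by
  induction hs using Submodule.span_induction with
  | mem s h =>
    obtain ⟨l, ⟨hl, hg⟩, rfl⟩ := h
    obtain rfl := List.length_eq_zero_iff.1 hl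
    exact ⟨1, fun h => absurd hg.symm h, by simp⟩
  | zero => exact ⟨0, fun _ => rfl, by simp⟩
  | add s t _ _ hs ht =>
    obtain ⟨c, hc, rfl⟩ := hs
    obtain ⟨d, hd, rfl⟩ := ht
    exact ⟨c + d, fun h => by rw [hc h, hd h, add_zero], by simp⟩
  | smul r s _ hs =>
    obtain ⟨c, hc, rfl⟩ := hs
    exact ⟨r * c, fun h => by rw [hc h, mul_zero], by simp [Algebra.smul_def]⟩

theorem exists_symι_of_mem_symPiece {g : G} {s : SymAlg ε 𝒱} (hs : s ∈ symPiece ε 𝒱 1 g) :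
    ∃ x ∈ 𝒱 g, s = symι ε 𝒱 x := by
  have h : symPiece ε 𝒱 1 g ≤ (𝒱 g).map (symι ε 𝒱) := by
    refine Submodule.span_le.2 ?_
    rintro _ ⟨l, ⟨hl, rfl⟩, rfl⟩
    obtain ⟨p, rfl⟩ := List.length_eq_one_iff.1 hl
    exact ⟨p.2, by simp, by simp⟩
  obtain ⟨x, hx, rfl⟩ := h hs
  exact ⟨x, hx, rfl⟩

theorem symι_mem_symPiece {g : G} {x : V} (hx : x ∈ 𝒱 g) : symι ε 𝒱 x ∈ symPiece ε 𝒱 1 g :=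
  Submodule.subset_span ⟨[⟨g, x, hx⟩], by simp⟩

theorem AlgFiltration.algebraMap_gr {A : Type t} [Ring A] [Algebra K A] (fil : AlgFiltration K A)
    (c : K) : algebraMap K fil.gr c = fil.symbol 0 ⟨algebraMap K A c, fil.algebraMap_mem c⟩ := rfl

namespace PreModel

variable {A : PreModel.{u, v, w, t} ε 𝒱} [DecidableEq G]

/-- A graded linear lift `V → F₁ A` of the isomorphism of `V` with the component of order `1` of
`gr(A)`. -/
structure IsLift (A : PreModel.{u, v, w, t} ε 𝒱) (i : V →ₗ[K] A.carrier) : Prop where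
  mem_fil : ∀ x, i x ∈ A.fil.F 1
  symbol : ∀ x, A.fil.symbol 1 ⟨i x, mem_fil x⟩ = A.φ (symι ε 𝒱 x)
  mem_grading : ∀ g x, x ∈ 𝒱 g → i x ∈ A.grading g

/-- `F₀ A` consists of the scalars, which have degree zero. -/
theorem IsObject.exists_algebraMap (hA : A.IsObject) {g : G} {a : A.carrier}
    (ha : a ∈ A.fil.F 0) (hg : a ∈ A.grading g) :
    ∃ c : K, (g ≠ 0 → c = 0) ∧ a = algebraMap K _ c := by
  obtain ⟨s, hs⟩ := hA.bijective.2 (A.fil.symbol 0 ⟨a, ha⟩)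
  have h : s ∈ symPiece ε 𝒱 0 g := by
    rw [hA.graded, hs]
    exact Submodule.mem_map_of_mem (show (⟨a, ha⟩ : ↥(A.fil.F 0)) ∈ _ from hg)
  obtain ⟨c, hc, rfl⟩ := exists_algebraMap_of_mem_symPiece h
  refine ⟨c, hc, ?_⟩
  rw [AlgHom.commutes, AlgFiltration.algebraMap_gr, eq_comm, AlgFiltration.symbol_eq_iff] at hs
  exact sub_eq_zero.1 ((Submodule.mem_bot K).1 hs)

theorem IsObject.algebraMap_injective (hA : A.IsObject) :
    Function.Injective (algebraMap K A.carrier) := by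
  rw [injective_iff_map_eq_zero]
  intro c hc
  refine (injective_iff_map_eq_zero _).1 (algebraMap_symAlg_injective (ε := ε) (𝒱 := 𝒱)) c
    ((injective_iff_map_eq_zero _).1 hA.bijective.1 _ ?_)
  rw [AlgHom.commutes, AlgFiltration.algebraMap_gr, AlgFiltration.symbol_eq_zero_iff]
  exact (Submodule.mem_bot K).2 hc

theorem IsObject.algebraMap_mem_grading (hA : A.IsObject) (c : K) :
    algebraMap K A.carrier c ∈ A.grading 0 := by
  rw [Algebra.algebraMap_eq_smul_one]
  exact Submodule.smul_mem _ _ hA.gradedMonoid.one_mem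

/-- The sum of the scalars and of the image of a lift is direct. -/
theorem IsLift.eq_zero {i : V →ₗ[K] A.carrier} (hi : A.IsLift i) (hA : A.IsObject) {x : V} {c : K}
    (h : i x + algebraMap K _ c = 0) : x = 0 ∧ c = 0 := by
  have hx : x = 0 := by
    refine (injective_iff_map_eq_zero _).1 (symι_injective (ε := ε) (𝒱 := 𝒱)) x
      ((injective_iff_map_eq_zero _).1 hA.bijective.1 _ ?_)
    rw [← hi.symbol, AlgFiltration.symbol_eq_zero_iff]
    change i x ∈ A.fil.F 0
    rw [eq_neg_of_add_eq_zero_left h]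
    exact Submodule.neg_mem _ (A.fil.algebraMap_mem c)
  refine ⟨hx, (injective_iff_map_eq_zero _).1 hA.algebraMap_injective c ?_⟩
  simpa [hx] using h

theorem IsLift.eq_of_eq {i : V →ₗ[K] A.carrier} (hi : A.IsLift i) (hA : A.IsObject) {x y : V}
    {c d : K} (h : i x + algebraMap K _ c = i y + algebraMap K _ d) : x = y ∧ c = d := by
  have := hi.eq_zero hA (x := x - y) (c := c - d) (by
    rw [map_sub, map_sub, sub_add_sub_comm, h, sub_self])
  exact ⟨sub_eq_zero.1 this.1, sub_eq_zero.1 this.2⟩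

/-- `F₁ A ∩ A_g` is the sum of the image of `V_g` and, if `g = 0`, of the scalars. -/
theorem IsLift.exists_eq {i : V →ₗ[K] A.carrier} (hi : A.IsLift i) (hA : A.IsObject) {g : G}
    {a : A.carrier} (ha : a ∈ A.fil.F 1) (hg : a ∈ A.grading g) :
    ∃ x ∈ 𝒱 g, ∃ c : K, (g ≠ 0 → c = 0) ∧ a = i x + algebraMap K _ c := by
  obtain ⟨s, hs⟩ := hA.bijective.2 (A.fil.symbol 1 ⟨a, ha⟩)
  have h : s ∈ symPiece ε 𝒱 1 g := by
    rw [hA.graded, hs]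
    exact Submodule.mem_map_of_mem (show (⟨a, ha⟩ : ↥(A.fil.F 1)) ∈ _ from hg)
  obtain ⟨x, hx, rfl⟩ := exists_symι_of_mem_symPiece h
  rw [← hi.symbol, eq_comm, AlgFiltration.symbol_eq_iff] at hs
  obtain ⟨c, hc, e⟩ := hA.exists_algebraMap (g := g) (a := a - i x) hs
    (Submodule.sub_mem _ hg (hi.mem_grading g x hx))
  exact ⟨x, hx, c, hc, by rw [← e]; abel⟩

/-- A homogeneous lift exists: on a homogeneous basis, choose homogeneous representatives. -/
theorem IsObject.exists_isLift [DirectSum.Decomposition 𝒱] (hA : A.IsObject) :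
    ∃ i : V →ₗ[K] A.carrier, A.IsLift i := by
  obtain ⟨B, b, deg, hb, hs⟩ := exists_homogeneous_basis 𝒱
  have h : ∀ j, ∃ a : ↥(A.fil.F 1), (a : A.carrier) ∈ A.grading (deg j) ∧
      A.fil.symbol 1 a = A.φ (symι ε 𝒱 (b j)) := by
    intro j
    obtain ⟨a, ha, e⟩ := (hA.graded 1 (deg j) _).1 (symι_mem_symPiece (hb j))
    exact ⟨a, ha, e⟩
  choose a ha he using h
  let i : V →ₗ[K] ↥(A.fil.F 1) := b.constr K a
  refine ⟨(A.fil.F 1).subtype ∘ₗ i, ⟨fun x => SetLike.coe_mem _, fun x => ?_, fun g x hx => ?_⟩⟩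
  · have e : A.fil.symbol 1 ∘ₗ i = A.φ.toLinearMap ∘ₗ symι ε 𝒱 :=
      b.ext fun j => by simp [i, he]
    exact congrArg (fun f => f x) e
  · have hle : 𝒱 g ≤ (A.grading g).comap ((A.fil.F 1).subtype ∘ₗ i) := by
      refine (hs g).trans (Submodule.span_le.2 ?_)
      rintro _ ⟨j, rfl, rfl⟩
      simpa [i] using ha j
    exact hle hx

/-! ### Maps of objects -/

variable {B : PreModel.{u, v, w, t} ε 𝒱}

omit [AddCommGroup G] [DecidableEq G] in
theorem Hom.map_φ (f : Hom A B) (s : SymAlg ε 𝒱) :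
    AlgFiltration.map f.Ψ f.map_fil (A.φ s) = B.φ s :=
  congrArg (fun φ => φ s) f.comm

theorem Hom.map_injective (f : Hom A B) (hA : A.IsObject) (hB : B.IsObject) :
    Function.Injective (AlgFiltration.map f.Ψ f.map_fil) := by
  intro y y' h
  obtain ⟨s, rfl⟩ := hA.bijective.2 y
  obtain ⟨s', rfl⟩ := hA.bijective.2 y'
  rw [f.map_φ, f.map_φ] at h
  rw [hB.bijective.1 h]

theorem Hom.mem_below (f : Hom A B) (hA : A.IsObject) (hB : B.IsObject) {n : ℕ} {a : A.carrier}
    (ha : a ∈ A.fil.F n) (h : f.Ψ a ∈ B.fil.below n) : a ∈ A.fil.below n := by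
  have h1 : A.fil.symbol n ⟨a, ha⟩ = 0 := by
    refine (injective_iff_map_eq_zero _).1 (f.map_injective hA hB) _ ?_
    rw [AlgFiltration.map_symbol, AlgFiltration.symbol_eq_zero_iff]
    exact h
  exact AlgFiltration.symbol_eq_zero_iff.1 h1

/-- A map of objects is strict: it reflects the filtration. -/
theorem Hom.mem_fil (f : Hom A B) (hA : A.IsObject) (hB : B.IsObject) {m n : ℕ} {a : A.carrier}
    (ha : a ∈ A.fil.F m) (h : f.Ψ a ∈ B.fil.F n) : a ∈ A.fil.F n := by
  induction m with
  | zero => exact A.fil.mono (Nat.zero_le n) ha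
  | succ m ih =>
    rcases Nat.lt_or_ge m n with hmn | hmn
    · exact A.fil.mono hmn ha
    · exact ih (f.mem_below hA hB ha (B.fil.mono hmn h))

theorem Hom.Ψ_injective (f : Hom A B) (hA : A.IsObject) (hB : B.IsObject) :
    Function.Injective f.Ψ := by
  rw [injective_iff_map_eq_zero]
  intro a ha
  obtain ⟨m, hm⟩ := hA.exhaustive a
  have h0 : a ∈ A.fil.F 0 := f.mem_fil hA hB hm (by rw [ha]; exact Submodule.zero_mem _)
  exact (Submodule.mem_bot K).1
    (f.mem_below hA hB h0 (by rw [ha]; exact Submodule.zero_mem _))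

/-- A map of objects is surjective on `Fₙ ∩ A_g`: approximate by symbols, order by order. -/
theorem Hom.exists_preimage (f : Hom A B) (hA : A.IsObject) (hB : B.IsObject) (n : ℕ) {g : G}
    {b : B.carrier} (hb : b ∈ B.fil.F n) (hg : b ∈ B.grading g) :
    ∃ a ∈ A.fil.F n, a ∈ A.grading g ∧ f.Ψ a = b := by
  have step : ∀ n b, b ∈ B.fil.F n → b ∈ B.grading g →
      ∃ a ∈ A.fil.F n, a ∈ A.grading g ∧ b - f.Ψ a ∈ B.fil.below n := by
    intro n b hb hg
    obtain ⟨s, hs⟩ := hB.bijective.2 (B.fil.symbol n ⟨b, hb⟩)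
    have h : s ∈ symPiece ε 𝒱 n g := by
      rw [hB.graded, hs]
      exact Submodule.mem_map_of_mem (show (⟨b, hb⟩ : ↥(B.fil.F n)) ∈ _ from hg)
    obtain ⟨a, ha, e⟩ := (hA.graded n g s).1 h
    refine ⟨a, a.2, ha, ?_⟩
    rw [← f.map_φ, ← e, AlgFiltration.map_symbol, eq_comm, AlgFiltration.symbol_eq_iff] at hs
    exact hs
  induction n generalizing b with
  | zero =>
    obtain ⟨a, ha, hag, h⟩ := step 0 b hb hg
    exact ⟨a, ha, hag, (sub_eq_zero.1 ((Submodule.mem_bot K).1 h)).symm⟩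
  | succ n ih =>
    obtain ⟨a, ha, hag, h⟩ := step (n + 1) b hb hg
    obtain ⟨a', ha', hag', e⟩ := ih h (Submodule.sub_mem _ hg (f.map_grading g a hag))
    exact ⟨a + a', Submodule.add_mem _ ha (A.fil.mono n.le_succ ha'),
      Submodule.add_mem _ hag hag', by rw [map_add, e, add_sub_cancel]⟩

/-- Every map of objects is an isomorphism, because the map of associated graded algebras is
bijective. -/
theorem Hom.exists_inverse (f : Hom A B) (hA : A.IsObject) (hB : B.IsObject) :
    ∃ f' : Hom B A, f'.Ψ.comp f.Ψ = AlgHom.id K _ ∧ f.Ψ.comp f'.Ψ = AlgHom.id K _ := by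
  have hfil : ∀ n b, b ∈ B.fil.F n → ∃ a ∈ A.fil.F n, f.Ψ a = b := by
    intro n
    suffices h : B.fil.F n ≤ (A.fil.F n).map f.Ψ.toLinearMap from fun b hb => h hb
    refine (hB.homogeneous n).trans (iSup_le fun g b hb => ?_)
    obtain ⟨a, ha, -, rfl⟩ := f.exists_preimage hA hB n hb.1 hb.2
    exact ⟨a, ha, rfl⟩
  have hsurj : Function.Surjective f.Ψ := fun b => by
    obtain ⟨n, hn⟩ := hB.exhaustive b
    obtain ⟨a, -, e⟩ := hfil n b hn
    exact ⟨a, e⟩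
  let e := AlgEquiv.ofBijective f.Ψ ⟨f.Ψ_injective hA hB, hsurj⟩
  have he : ∀ a, e.symm (f.Ψ a) = a := fun a => e.symm_apply_apply a
  have hmf : ∀ n b, b ∈ B.fil.F n → (e.symm : B.carrier →ₐ[K] A.carrier) b ∈ A.fil.F n := by
    intro n b hb
    obtain ⟨a, ha, rfl⟩ := hfil n b hb
    change e.symm (f.Ψ a) ∈ _
    rwa [he]
  refine ⟨⟨e.symm, fun g b hb => ?_, hmf, ?_⟩, ?_, ?_⟩
  · obtain ⟨n, hn⟩ := hB.exhaustive b
    obtain ⟨a, -, ha, rfl⟩ := f.exists_preimage hA hB n hn hb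
    change e.symm (f.Ψ a) ∈ _
    rwa [he]
  · rw [← f.comm, ← AlgHom.comp_assoc]
    have : (AlgFiltration.map (e.symm : B.carrier →ₐ[K] A.carrier) hmf).comp
        (AlgFiltration.map f.Ψ f.map_fil) = AlgHom.id K _ :=
      AlgFiltration.gr_algHom_ext fun n a => by
        rw [AlgHom.comp_apply, AlgFiltration.map_symbol, AlgFiltration.map_symbol]
        exact AlgFiltration.symbol_congr rfl (he a)
    rw [this, AlgHom.id_comp]
  · exact AlgHom.ext he
  · exact AlgHom.ext fun b => e.apply_symm_apply b

end PreModel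

theorem Model.isIsomorphic_of_hom [DecidableEq G] {A B : Model.{u, v, w, t} ε 𝒱}
    (f : PreModel.Hom A.toPreModel B.toPreModel) : CategoryTheory.IsIsomorphic A B := by
  obtain ⟨f', h, h'⟩ := f.exists_inverse A.isObject B.isObject
  exact ⟨{
    hom := f
    inv := f'
    hom_inv_id := PreModel.Hom.ext h
    inv_hom_id := PreModel.Hom.ext h' }⟩

end LowDegree

/-! ### Lifts and their commutators -/

section Classification

variable {K : Type u} [Field K] {G : Type w} [AddCommGroup G] [DecidableEq G] {ε : G → G → Kˣ}
  {V : Type v} [AddCommGroup V] [Module K V] {𝒱 : G → Submodule K V} [DirectSum.Decomposition 𝒱]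

omit [AddCommGroup G] in
/-- Two linear maps out of `V` agree if they agree on homogeneous vectors. -/
theorem linearMap_ext_homogeneous {M : Type*} [AddCommMonoid M] [Module K M] {f f' : V →ₗ[K] M}
    (h : ∀ g x, x ∈ 𝒱 g → f x = f' x) : f = f' := by
  obtain ⟨B, b, deg, hb, -⟩ := exists_homogeneous_basis 𝒱
  exact b.ext fun j => h _ _ (hb j)

namespace PreModel

variable {A : PreModel.{u, v, w, t} ε 𝒱} {i i' : V →ₗ[K] A.carrier}

/-- The lift `i` satisfies the defining relations of `U_ω(L)`. -/
def Satisfies (A : PreModel.{u, v, w, t} ε 𝒱) (i : V →ₗ[K] A.carrier) (L : LieStr ε 𝒱)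
    (ω : ↥L.Z2) : Prop :=
  ∀ g h x y, x ∈ 𝒱 g → y ∈ 𝒱 h → i x * i y - (ε g h : K) • (i y * i x)
    = i (L.bracket x y) + algebraMap K _ (ω.1 x y)

/-- Lifts are unique up to graded linear forms. -/
theorem IsLift.exists_cochain (hi : A.IsLift i) (hi' : A.IsLift i') (hA : A.IsObject) :
    ∃ f ∈ cochain1 𝒱, ∀ x, i x = i' x + algebraMap K _ (f x) := by
  have key : ∀ g x, x ∈ 𝒱 g → ∃ c : K, (g ≠ 0 → c = 0) ∧ i x - i' x = algebraMap K _ c := by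
    intro g x hx
    refine hA.exists_algebraMap ?_ (Submodule.sub_mem _ (hi.mem_grading g x hx)
      (hi'.mem_grading g x hx))
    have h := (hi.symbol x).trans (hi'.symbol x).symm
    exact AlgFiltration.symbol_eq_iff.1 h
  obtain ⟨B, b, deg, hb, hs⟩ := exists_homogeneous_basis 𝒱
  choose c hc using fun j => (key _ _ (hb j))
  let f : V →ₗ[K] K := b.constr K c
  have hf : i = i' + (Algebra.linearMap K A.carrier) ∘ₗ f := b.ext fun j => by
    simp only [f, LinearMap.add_apply, LinearMap.comp_apply, Module.Basis.constr_basis,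
      Algebra.linearMap_apply, ← (hc j).2]
    abel
  have hf' : ∀ x, i x = i' x + algebraMap K _ (f x) := fun x => congrArg (fun φ => φ x) hf
  refine ⟨f, fun g x hx hg => ?_, hf'⟩
  obtain ⟨d, hd, e⟩ := key g x hx
  refine (injective_iff_map_eq_zero _).1 hA.algebraMap_injective _ ?_
  rw [← sub_eq_iff_eq_add'.2 (hf' x), e, hd hg, map_zero]

omit [DirectSum.Decomposition 𝒱] in
theorem IsLift.add_cochain (hi : A.IsLift i) (hA : A.IsObject) {f : V →ₗ[K] K}
    (hf : f ∈ cochain1 𝒱) : A.IsLift (i + (Algebra.linearMap K A.carrier) ∘ₗ f) where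
  mem_fil x := Submodule.add_mem _ (hi.mem_fil x)
    (A.fil.mono zero_le_one (A.fil.algebraMap_mem _))
  symbol x := by
    rw [← hi.symbol, AlgFiltration.symbol_eq_iff]
    change i x + algebraMap K _ (f x) - i x ∈ A.fil.F 0
    rw [add_sub_cancel_left]
    exact A.fil.algebraMap_mem _
  mem_grading g x hx := by
    refine Submodule.add_mem _ (hi.mem_grading g x hx) ?_
    change algebraMap K _ (f x) ∈ _
    by_cases hg : g = 0
    · subst hg
      exact hA.algebraMap_mem_grading _
    · rw [hf g x hx hg, map_zero]
      exact Submodule.zero_mem _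

omit [DecidableEq G] [DirectSum.Decomposition 𝒱] in
/-- Adding a graded linear form to a lift does not change the `ε`-commutators: `f x` and `f y` are
scalars, and vanish unless the degree of `x` or `y`, respectively, is zero. -/
theorem commutator_add_cochain (hε : IsBicharacter ε) (i : V →ₗ[K] A.carrier) {f : V →ₗ[K] K}
    (hf : f ∈ cochain1 𝒱) {g h : G} {x y : V} (hx : x ∈ 𝒱 g) (hy : y ∈ 𝒱 h) :
    (i x + algebraMap K _ (f x)) * (i y + algebraMap K _ (f y))
        - (ε g h : K) • ((i y + algebraMap K _ (f y)) * (i x + algebraMap K _ (f x)))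
      = i x * i y - (ε g h : K) • (i y * i x) := by
  have h1 : f y * ε g h = f y := by
    have := hε.mul_eq_of_degree_eq_zero (g := h) (h := 0) g (c := f y)
      (fun h0 => hf h y hy (by simpa using h0))
    rwa [← Units.val_mul, ← hε.add_right, add_zero] at this
  have h2 : f x * ε h g = f x := by
    have := hε.mul_eq_of_degree_eq_zero (g := g) (h := 0) h (c := f x)
      (fun h0 => hf g x hx (by simpa using h0))
    rwa [← Units.val_mul, ← hε.add_right, add_zero] at this
  have h3 : (ε g h : K) * ε h g = 1 := by rw [← Units.val_mul, hε.antisymm, Units.val_one]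
  have h2' : f x * ε g h = f x := by
    linear_combination -(ε g h : K) * h2 + f x * h3
  simp only [Algebra.algebraMap_eq_smul_one, mul_add, add_mul, mul_smul_comm, smul_mul_assoc,
    mul_one, one_mul, smul_add, smul_smul]
  match_scalars
  all_goals try ring1
  · linear_combination -h2'
  · linear_combination -h1
  · linear_combination -(f y) * h2'

/-- The bracket and the class of the cocycle are determined by the object. -/
theorem IsLift.eq_of_satisfies (hε : IsBicharacter ε) (hA : A.IsObject) (hi : A.IsLift i)
    (hi' : A.IsLift i') {L L' : LieStr ε 𝒱} {ω : ↥L.Z2} {ω' : ↥L'.Z2}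
    (h : A.Satisfies i L ω) (h' : A.Satisfies i' L' ω') : L = L' ∧ ω.1 - ω'.1 ∈ L.B2 := by
  obtain ⟨f, hf, hif⟩ := hi.exists_cochain hi' hA
  have key : ∀ g k x y, x ∈ 𝒱 g → y ∈ 𝒱 k → L.bracket x y = L'.bracket x y ∧
      f (L.bracket x y) + ω.1 x y = ω'.1 x y := by
    intro g k x y hx hy
    refine hi'.eq_of_eq hA ?_
    rw [← h' g k x y hx hy, ← commutator_add_cochain hε i' hf hx hy, ← hif, ← hif,
      h g k x y hx hy, hif, map_add, add_assoc]
  refine ⟨LieStr.ext (linearMap_ext_homogeneous (𝒱 := 𝒱) fun g x hx =>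
    linearMap_ext_homogeneous (𝒱 := 𝒱) fun k y hy => (key g k x y hx hy).1), f, hf, ?_⟩
  refine linearMap_ext_homogeneous (𝒱 := 𝒱) fun g x hx =>
    linearMap_ext_homogeneous (𝒱 := 𝒱) fun k y hy => ?_
  change -f (L.bracket x y) = ω.1 x y - ω'.1 x y
  rw [← (key g k x y hx hy).2]
  ring

omit [AddCommGroup G] [DecidableEq G] [DirectSum.Decomposition 𝒱] in
theorem Hom.isLift {B : PreModel.{u, v, w, t} ε 𝒱} (f : Hom A B) (hi : A.IsLift i) :
    B.IsLift (f.Ψ.toLinearMap ∘ₗ i) where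
  mem_fil x := f.map_fil 1 _ (hi.mem_fil x)
  symbol x := by
    rw [← f.map_φ, ← hi.symbol, AlgFiltration.map_symbol]
    rfl
  mem_grading g x hx := f.map_grading g _ (hi.mem_grading g x hx)

omit [DecidableEq G] [DirectSum.Decomposition 𝒱] in
theorem Hom.satisfies {B : PreModel.{u, v, w, t} ε 𝒱} (f : Hom A B) {L : LieStr ε 𝒱} {ω : ↥L.Z2}
    (h : A.Satisfies i L ω) : B.Satisfies (f.Ψ.toLinearMap ∘ₗ i) L ω := by
  intro g k x y hx hy
  have := congrArg f.Ψ (h g k x y hx hy)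
  simpa using this

/-- The universal property of `U_ω(L)` among objects. -/
theorem IsLift.exists_hom {A : PreModel.{u, v, w, max u v} ε 𝒱} {i : V →ₗ[K] A.carrier}
    (hA : A.IsObject) (hi : A.IsLift i) {L : LieStr ε 𝒱} {ω : ↥L.Z2} (h : A.Satisfies i L ω) :
    Nonempty (Hom (L.env ω) A) := by
  let Ψ : L.Env ω →ₐ[K] A.carrier := L.envLift ω i h
  have hcomp : Ψ.toLinearMap.comp (L.envι ω) = i := LinearMap.ext fun x => L.envLift_envι ω i h x
  have hword : ∀ l : List (Σ g, ↥(𝒱 g)), (l.map fun p => i (p.2 : V)).prod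
      ∈ A.fil.F l.length ⊓ A.grading (l.map Sigma.fst).sum := by
    intro l
    induction l with
    | nil => exact ⟨A.fil.one_mem, hA.gradedMonoid.one_mem⟩
    | cons p l ih =>
      simp only [List.map_cons, List.prod_cons, List.sum_cons, List.length_cons]
      rw [add_comm l.length]
      exact ⟨A.fil.mul_mem (hi.mem_fil _) ih.1,
        hA.gradedMonoid.mul_mem (hi.mem_grading _ _ (SetLike.coe_mem _)) ih.2⟩
  have hmap : ∀ (P : ℕ → G → Prop) (a : L.Env ω), a ∈ wordSpan 𝒱 (L.envι ω) P →
      Ψ a ∈ wordSpan 𝒱 i P := by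
    intro P a ha
    have := Submodule.mem_map_of_mem (f := Ψ.toLinearMap) ha
    rwa [map_wordSpan, hcomp] at this
  have hfil : ∀ n a, a ∈ (L.envFiltration ω).F n → Ψ a ∈ A.fil.F n := by
    intro n a ha
    have hle : (wordSpan 𝒱 i fun m _ => m ≤ n) ≤ A.fil.F n := by
      refine Submodule.span_le.2 ?_
      rintro _ ⟨l, hl, rfl⟩
      exact A.fil.mono hl (hword l).1
    exact hle (hmap _ a ha)
  refine ⟨⟨Ψ, fun g a ha => ?_, hfil, ?_⟩⟩
  · have hle : (wordSpan 𝒱 i fun _ g' => g' = g) ≤ A.grading g := by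
      refine Submodule.span_le.2 ?_
      rintro _ ⟨l, rfl, rfl⟩
      exact (hword l).2
    exact hle (hmap _ a ha)
  · refine sym_algHom_ext fun x => ?_
    rw [← hi.symbol]
    refine (congrArg (AlgFiltration.map Ψ hfil) (L.envφ_symι ω x)).trans ?_
    refine (AlgFiltration.map_symbol Ψ hfil _).trans ?_
    exact AlgFiltration.symbol_congr rfl (L.envLift_envι ω i h x)

omit [AddCommGroup G] in
/-- The `ε`-commutator `a b - ε(|x|, |y|) b a` of lifts `a = i x`, `b = i y` of homogeneous vectors,
as a bilinear map. -/
theorem exists_commutator (i : V →ₗ[K] A.carrier) :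
    ∃ κ : V →ₗ[K] V →ₗ[K] A.carrier, ∀ g h x y, x ∈ 𝒱 g → y ∈ 𝒱 h →
      κ x y = i x * i y - (ε g h : K) • (i y * i x) := by
  obtain ⟨B, b, deg, hb, hs⟩ := exists_homogeneous_basis 𝒱
  let m : V →ₗ[K] V →ₗ[K] A.carrier := (LinearMap.mul K A.carrier).compl₁₂ i i
  let κ : V →ₗ[K] V →ₗ[K] A.carrier := b.constr K fun j => b.constr K fun k =>
    m (b j) (b k) - (ε (deg j) (deg k) : K) • m (b k) (b j)
  refine ⟨κ, fun g h x y hx hy => ?_⟩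
  have h1 : ∀ j, deg j = g → κ (b j) y = (m - (ε g h : K) • m.flip) (b j) y := by
    rintro j rfl
    have hle : 𝒱 h ≤ LinearMap.eqLocus (κ (b j)) ((m - (ε (deg j) h : K) • m.flip) (b j)) := by
      refine (hs h).trans (Submodule.span_le.2 ?_)
      rintro _ ⟨k, rfl, rfl⟩
      change κ (b j) (b k) = _
      simp [κ]
    exact hle hy
  have hle : 𝒱 g ≤ LinearMap.eqLocus (κ.flip y) ((m - (ε g h : K) • m.flip).flip y) := by
    refine (hs g).trans (Submodule.span_le.2 ?_)
    rintro _ ⟨j, hj, rfl⟩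
    exact h1 j hj
  exact hle hx

omit [AddCommGroup G] [DecidableEq G] [DirectSum.Decomposition 𝒱] in
/-- The relation `x y = ε(|x|, |y|) y x` in `S(V)` makes `ε`-commutators of lifts drop in order. -/
theorem IsLift.commutator_mem (hi : A.IsLift i) {g h : G} {x y : V} (hx : x ∈ 𝒱 g)
    (hy : y ∈ 𝒱 h) : i x * i y - (ε g h : K) • (i y * i x) ∈ A.fil.F 1 := by
  have e := RingQuot.mkAlgHom_rel K (SymRel.comm (ε := ε) (𝒱 := 𝒱) hx hy)
  simp only [map_mul, Units.smul_def, map_smul] at e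
  have e' := congrArg A.φ e
  simp only [map_mul, map_smul] at e'
  change A.φ (symι ε 𝒱 x) * A.φ (symι ε 𝒱 y)
    = (ε g h : K) • (A.φ (symι ε 𝒱 y) * A.φ (symι ε 𝒱 x)) at e'
  rw [← hi.symbol, ← hi.symbol, AlgFiltration.symbol_mul, AlgFiltration.symbol_mul, ← map_smul,
    AlgFiltration.symbol_eq_iff] at e'
  exact e'

/-- The `ε`-commutators of a lift are the values of an `ε`-Lie bracket and of a cocycle: the Jacobi
and cocycle identities come from the Jacobi identity for `ε`-commutators in an associative
algebra. -/
theorem IsLift.exists_satisfies (hε : IsBicharacter ε) (hA : A.IsObject) (hi : A.IsLift i) :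
    ∃ (L : LieStr ε 𝒱) (ω : ↥L.Z2), A.Satisfies i L ω := by
  have hinv : ∀ g h, (ε g h : K) * ε h g = 1 := fun g h => by
    rw [← Units.val_mul, hε.antisymm, Units.val_one]
  obtain ⟨κ, hκ⟩ := exists_commutator (ε := ε) (𝒱 := 𝒱) i
  -- A linear left inverse of the embedding of `V ⊕ K` splits the commutators into their parts.
  obtain ⟨r, hr⟩ := (i.coprod (Algebra.linearMap K A.carrier)).exists_leftInverse_of_injective
    (LinearMap.ker_eq_bot'.2 fun p hp => by
      have := hi.eq_zero hA (x := p.1) (c := p.2) (by simpa using hp)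
      exact Prod.ext this.1 this.2)
  have hr' : ∀ x c, r (i x + algebraMap K _ c) = (x, c) := fun x c => by
    have := congrArg (fun f => f (x, c)) hr
    simpa using this
  let β : V →ₗ[K] V →ₗ[K] V := κ.compr₂ (LinearMap.fst K V K ∘ₗ r)
  let ω : V →ₗ[K] V →ₗ[K] K := κ.compr₂ (LinearMap.snd K V K ∘ₗ r)
  have key : ∀ g h x y, x ∈ 𝒱 g → y ∈ 𝒱 h → β x y ∈ 𝒱 (g + h) ∧ (g + h ≠ 0 → ω x y = 0) ∧
      κ x y = i (β x y) + algebraMap K _ (ω x y) := by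
    intro g h x y hx hy
    have hmem : κ x y ∈ A.grading (g + h) := by
      rw [hκ g h x y hx hy]
      refine Submodule.sub_mem _
        (hA.gradedMonoid.mul_mem (hi.mem_grading g x hx) (hi.mem_grading h y hy))
        (Submodule.smul_mem _ _ ?_)
      rw [add_comm]
      exact hA.gradedMonoid.mul_mem (hi.mem_grading h y hy) (hi.mem_grading g x hx)
    have hfil : κ x y ∈ A.fil.F 1 := by
      rw [hκ g h x y hx hy]
      exact hi.commutator_mem hx hy
    obtain ⟨v, hv, c, hc, e⟩ := hi.exists_eq hA hfil hmem
    have h1 : β x y = v := by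
      change (r (κ x y)).1 = v
      rw [e, hr']
    have h2 : ω x y = c := by
      change (r (κ x y)).2 = c
      rw [e, hr']
    exact ⟨h1 ▸ hv, fun hg => h2 ▸ hc hg, by rw [h1, h2, e]⟩
  have hskew : ∀ g h x y, x ∈ 𝒱 g → y ∈ 𝒱 h →
      β x y = -((ε g h : K) • β y x) ∧ ω x y = -((ε g h : K) • ω y x) := by
    intro g h x y hx hy
    have e : κ x y = -((ε g h : K) • κ y x) := by
      rw [hκ g h x y hx hy, hκ h g y x hy hx, smul_sub, smul_smul, hinv, one_smul]
      abel
    refine ⟨?_, ?_⟩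
    · change (r (κ x y)).1 = -((ε g h : K) • (r (κ y x)).1)
      rw [e]
      simp
    · change (r (κ x y)).2 = -((ε g h : K) • (r (κ y x)).2)
      rw [e]
      simp
  -- The scalar `ω y z` drops out of the `ε`-commutator with `i x`.
  have hκβ : ∀ g h k x y z, x ∈ 𝒱 g → y ∈ 𝒱 h → z ∈ 𝒱 k → κ x (β y z)
      = i x * κ y z - ((ε g h : K) * ε g k) • (κ y z * i x) := by
    intro g h k x y z hx hy hz
    obtain ⟨h1, h2, h3⟩ := key h k y z hy hz
    have h4 := hε.mul_eq_of_degree_eq_zero g h2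
    rw [hκ g (h + k) x _ hx h1, eq_sub_of_add_eq h3.symm, hε.add_right, Units.val_mul]
    simp only [Algebra.algebraMap_eq_smul_one, mul_sub, sub_mul, mul_smul_comm, smul_mul_assoc,
      mul_one, one_mul, smul_sub, smul_smul, mul_comm _ (ω y z), h4]
    abel
  have hjac : ∀ g h k x y z, x ∈ 𝒱 g → y ∈ 𝒱 h → z ∈ 𝒱 k →
      (ε k g : K) • κ x (β y z) + (ε g h : K) • κ y (β z x) + (ε h k : K) • κ z (β x y) = 0 := by
    intro g h k x y z hx hy hz
    rw [hκβ g h k x y z hx hy hz, hκβ h k g y z x hy hz hx, hκβ k g h z x y hz hx hy,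
      hκ h k y z hy hz, hκ k g z x hz hx, hκ g h x y hx hy]
    have e1 := hinv g h
    have e2 := hinv h k
    have e3 := hinv k g
    simp only [mul_sub, sub_mul, mul_smul_comm, smul_mul_assoc, smul_sub, smul_smul, mul_assoc]
    match_scalars
    · linear_combination -(ε k g : K) * e2
    · linear_combination (ε k g : K) * ε h k * e1
    · linear_combination -(ε g h : K) * e3
    · linear_combination (ε g h : K) * ε h k * e3
    · linear_combination (ε g h : K) * ε k g * e2
    · linear_combination -(ε h k : K) * e1
  let L : LieStr ε 𝒱 :=
    { bracket := β
      graded := fun hx hy => (key _ _ _ _ hx hy).1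
      skew := fun hx hy => (hskew _ _ _ _ hx hy).1
      jacobi := fun hx hy hz => by
        have := congrArg (fun a => (r a).1) (hjac _ _ _ _ _ _ hx hy hz)
        simp only [map_add, map_smul, map_zero, Prod.fst_add, Prod.smul_fst, Prod.fst_zero] at this
        exact this }
  refine ⟨L, ⟨ω, fun _ _ x y hx hy => (key _ _ x y hx hy).2.1,
    fun g h x y hx hy => (hskew g h x y hx hy).2, fun g h k x y z hx hy hz => ?_⟩,
    fun g h x y hx hy => ?_⟩
  · have := congrArg (fun a => (r a).2) (hjac g h k x y z hx hy hz)
    simp only [map_add, map_smul, map_zero, Prod.snd_add, Prod.smul_snd, Prod.snd_zero] at this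
    exact this
  · rw [← hκ g h x y hx hy]
    exact (key g h x y hx hy).2.2

end PreModel

namespace LieStr

variable (L : LieStr ε 𝒱) (ω : ↥L.Z2)

omit [DecidableEq G] [DirectSum.Decomposition 𝒱] in
theorem envι_mem_envGrading {g : G} {x : V} (hx : x ∈ 𝒱 g) : L.envι ω x ∈ L.envGrading ω g :=
  Submodule.subset_span ⟨[⟨g, x, hx⟩], by simp⟩

theorem env_isLift : (L.env ω).IsLift (L.envι ω) where
  mem_fil := L.envι_mem ω
  symbol x := (L.envφ_symι ω x).symm
  mem_grading _ _ hx := L.envι_mem_envGrading ω hx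

theorem env_satisfies : (L.env ω).Satisfies (L.envι ω) L ω :=
  fun _ _ _ _ hx hy => L.envι_comm ω hx hy

/-- Isomorphic enveloping algebras come from the same bracket and from cohomologous cocycles. -/
theorem eq_of_hom [CharZero K] (hε : IsBicharacter ε) {L L' : LieStr ε 𝒱} {ω : ↥L.Z2}
    {ω' : ↥L'.Z2} (f : PreModel.Hom (L.env ω) (L'.env ω')) : L = L' ∧ ω.1 - ω'.1 ∈ L.B2 :=
  (f.isLift (L.env_isLift ω)).eq_of_satisfies hε (L'.env_isObject ω' hε) (L'.env_isLift ω')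
    (f.satisfies (L.env_satisfies ω)) (L'.env_satisfies ω')

/-- Cohomologous cocycles have isomorphic enveloping algebras, by a translation of the generators by
scalars. -/
theorem exists_hom_of_sub_mem [CharZero K] (hε : IsBicharacter ε) {ω ω' : ↥L.Z2}
    (h : ω.1 - ω'.1 ∈ L.B2) : Nonempty (PreModel.Hom (L.env ω) (L.env ω')) := by
  obtain ⟨f, hf, e⟩ := h
  have hobj := L.env_isObject ω' hε
  refine ((L.env_isLift ω').add_cochain hobj hf).exists_hom hobj fun g k x y hx hy => ?_
  have e' : -f (L.bracket x y) = ω.1 x y - ω'.1 x y :=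
    congrArg (fun φ : V →ₗ[K] V →ₗ[K] K => φ x y) e
  refine (PreModel.commutator_add_cochain (A := L.env ω') hε (L.envι ω') hf hx hy).trans ?_
  refine (L.envι_comm ω' hx hy).trans ?_
  change _ = L.envι ω' (L.bracket x y) + algebraMap K _ (f (L.bracket x y)) + algebraMap K _ _
  rw [add_assoc, ← map_add, show ω'.1 x y = f (L.bracket x y) + ω.1 x y by
    linear_combination e']

end LieStr

end Classification

/-! ### The classification -/

section Classification

variable {K : Type u} [Field K] [CharZero K] {G : Type w} [AddCommGroup G] [DecidableEq G]
  {ε : G → G → Kˣ} {V : Type v} [AddCommGroup V] [Module K V] {𝒱 : G → Submodule K V}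
  [DirectSum.Decomposition 𝒱]

/-- `(U_ω(L), φ_ω)` as an object of the category. -/
def LieStr.envModel (hε : IsBicharacter ε) (L : LieStr ε 𝒱) (ω : ↥L.Z2) :
    Model.{u, v, w, max u v} ε 𝒱 :=
  ⟨L.env ω, L.env_isObject ω hε⟩

theorem LieStr.isoClass_envModel_eq (hε : IsBicharacter ε) {L : LieStr ε 𝒱} {ω ω' : ↥L.Z2}
    (h : ω.1 - ω'.1 ∈ L.B2) :
    (L.envModel hε ω).isoClass = (L.envModel hε ω').isoClass := by
  obtain ⟨f⟩ := L.exists_hom_of_sub_mem hε h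
  exact Quotient.sound (Model.isIsomorphic_of_hom f)

/-- The isomorphism class of `(U_ω(L), φ_ω)`, as a function of the pair `(L, [ω])`. -/
def isoClassOfPair (hε : IsBicharacter ε) (p : Σ L : LieStr ε 𝒱, L.H2) :
    Model.IsoClasses.{u, v, w, max u v} ε 𝒱 :=
  Quotient.liftOn' p.2 (fun ω => (p.1.envModel hε ω).isoClass) fun _ _ h =>
    LieStr.isoClass_envModel_eq hε ((Submodule.quotientRel_def (p.1.B2.submoduleOf p.1.Z2)).1 h)

theorem isoClassOfPair_injective (hε : IsBicharacter ε) :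
    Function.Injective (isoClassOfPair (𝒱 := 𝒱) hε) := by
  rintro ⟨L, q⟩ ⟨L', q'⟩ h
  induction q using Submodule.Quotient.induction_on with
  | _ ω =>
  induction q' using Submodule.Quotient.induction_on with
  | _ ω' =>
  obtain ⟨e⟩ := Quotient.exact (s := CategoryTheory.isIsomorphicSetoid _) h
  obtain ⟨rfl, hω⟩ := LieStr.eq_of_hom hε e.hom
  congr 1
  exact (Submodule.Quotient.eq _).2 hω

theorem isoClassOfPair_surjective (hε : IsBicharacter ε) :
    Function.Surjective (isoClassOfPair (𝒱 := 𝒱) hε) := by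
  intro q
  induction q using Quotient.inductionOn with
  | _ A =>
  obtain ⟨i, hi⟩ := A.isObject.exists_isLift
  obtain ⟨L, ω, h⟩ := hi.exists_satisfies hε A.isObject
  obtain ⟨f⟩ := hi.exists_hom A.isObject h
  exact ⟨⟨L, L.classOf ω⟩, Quotient.sound (Model.isIsomorphic_of_hom (A := L.envModel hε ω) f)⟩

end Classification

end ColorLie

end

theorem theorem3p1 {K : Type u} [Field K] [CharZero K]
    {G : Type w} [AddCommGroup G] [DecidableEq G]
    (ε : G → G → Kˣ) (hε : ColorLie.IsBicharacter ε)
    {V : Type v} [AddCommGroup V] [Module K V]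
    (𝒱 : G → Submodule K V) [DirectSum.Decomposition 𝒱] :
    ∃ isObject : ∀ (L : ColorLie.LieStr ε 𝒱) (ω : ↥L.Z2), (L.env ω).IsObject,
    ∃ Φ : (Σ L : ColorLie.LieStr ε 𝒱, L.H2) ≃
        ColorLie.Model.IsoClasses.{u, v, w, max u v} ε 𝒱,
      (∀ (L : ColorLie.LieStr ε 𝒱) (ω : ↥L.Z2),
        Φ ⟨L, L.classOf ω⟩ = ColorLie.Model.isoClass ⟨L.env ω, isObject L ω⟩) ∧
      (∀ (L : ColorLie.LieStr ε 𝒱) (ω₁ ω₂ : ↥L.Z2),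
        CategoryTheory.IsIsomorphic
            (⟨L.env ω₁, isObject L ω₁⟩ : ColorLie.Model.{u, v, w, max u v} ε 𝒱)
            ⟨L.env ω₂, isObject L ω₂⟩ ↔
          ω₁.1 - ω₂.1 ∈ L.B2) := by
  refine ⟨fun L ω => L.env_isObject ω hε, Equiv.ofBijective (ColorLie.isoClassOfPair hε)
    ⟨ColorLie.isoClassOfPair_injective hε, ColorLie.isoClassOfPair_surjective hε⟩,
    fun L ω => rfl, fun L ω₁ ω₂ => ⟨fun h => ?_, fun h => ?_⟩⟩
  · obtain ⟨e⟩ := h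
    exact (ColorLie.LieStr.eq_of_hom hε e.hom).2
  · obtain ⟨f⟩ := L.exists_hom_of_sub_mem hε h
    exact ColorLie.Model.isIsomorphic_of_hom f
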